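/- Consider elections with parties $C=\{c_1,\dots,c_m\}$ and $n\ge 1$ voters, where voter $i$ has a strict preference order $O_i$ over $C$; write $\mathcal O=(O_1,\dots,O_n)$. The plurality score of a set $S\subseteq C$ under $\mathcal O$ is the number of voters whose top party lies in $S$, and (without a minimum support threshold) the seat share $\sigma(\mathcal O,S)$ is this score divided by the total score of all parties. In the problem Plurality$_0$-CBP one is given $\mathcal O$, a coalition $A\subseteq C$, a preferred party $p\in A$, a budget $B\in\mathbb N$, a target support $\varphi\in[0,1]\cap\mathbb Q$, a target ratio $\rho\in[0,1]\cap\mathbb Q$, and the price data of the bribery type. One has to decide whether there is a sequence $\hat{\mathcal O}=(\hat O_1,\dots,\hat O_n)$ of permissible new preference orders such that (a) $\sum_{i}\pi_i(O_i,\hat O_i)\le B$, (b) $\sigma(\hat{\mathcal O},A)\ge\varphi\cdot\sigma(\hat{\mathcal O},C)$, and (c) $\sigma(\hat{\mathcal O},\{p\})\ge\rho\cdot\sigma(\hat{\mathcal O},A)$. For each $i$ let $D_i$ be the set of ordered pairs $(x,y)$ such that $y$ is below $x$ in $O_i$ and above $x$ in $\hat O_i$. In swap-bribery every $\hat O_i$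 is permissible and $\pi_i(O_i,\hat O_i)=\sum_{(x,y)\in D_i}sw_i(x,y)$ for given prices $sw_i(x,y)\in\mathbb N$. In coalition-shift-bribery $\hat O_i$ is permissible if no $x\in A$ that is above some $y\notin A$ in $O_i$ is below $y$ in $\hat O_i$, and $\pi_i(O_i,\hat O_i)=s_i(|D_i|)$ for given non-decreasing functions $s_i:\mathbb N\to\mathbb N$, specified by their values at $0,\dots,\binom m2$. Theorem. For swap-bribery and for coalition-shift-bribery, Plurality$_0$-CBP is solvable by a deterministic algorithm in time polynomial in the size of the instance, all numbers being written in binary (time is measured on a random access machine with logarithmic cost). -/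

import Mathlib

/-! ## Computation model: random access machine with logarithmic cost -/

namespace RAM

/-- A machine has registers, addressed directly by the program, and a main memory, addressed
indirectly through registers. Every cell holds a natural number. -/
structure State where
  reg : ℕ → ℕ
  mem : ℕ → ℕ

def State.setReg (s : State) (d v : ℕ) : State := { s with reg := Function.update s.reg d v }

def State.setMem (s : State) (a v : ℕ) : State := { s with mem := Function.update s.mem a v }

/-- Programs. `d`, `a`, `b`, `r` are register names, `k` is a constant. -/
inductive Prog where
  | const (d k : ℕ)
  | move (d a : ℕ)
  | add (d a b : ℕ)
  | sub (d a b : ℕ)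
  | mul (d a b : ℕ)
  | load (d a : ℕ)
  | store (a b : ℕ)
  | seq (p q : Prog)
  | ifNZ (r : ℕ) (p q : Prog)
  | whileNZ (r : ℕ) (p : Prog)

/-- `Exec p s s' t`: started in `s`, the program `p` halts in `s'` after a run of total cost `t`.
Every instruction and every test costs one plus the bit lengths of all the numbers (operands and
addresses) that it handles. -/
inductive Exec : Prog → State → State → ℕ → Prop
  | const (s : State) (d k : ℕ) :
      Exec (.const d k) s (s.setReg d k) (1 + k.size)
  | move (s : State) (d a : ℕ) :
      Exec (.move d a) s (s.setReg d (s.reg a)) (1 + (s.reg a).size)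
  | add (s : State) (d a b : ℕ) :
      Exec (.add d a b) s (s.setReg d (s.reg a + s.reg b))
        (1 + (s.reg a).size + (s.reg b).size)
  | sub (s : State) (d a b : ℕ) :
      Exec (.sub d a b) s (s.setReg d (s.reg a - s.reg b))
        (1 + (s.reg a).size + (s.reg b).size)
  | mul (s : State) (d a b : ℕ) :
      Exec (.mul d a b) s (s.setReg d (s.reg a * s.reg b))
        (1 + (s.reg a).size + (s.reg b).size)
  | load (s : State) (d a : ℕ) :
      Exec (.load d a) s (s.setReg d (s.mem (s.reg a)))
        (1 + (s.reg a).size + (s.mem (s.reg a)).size)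
  | store (s : State) (a b : ℕ) :
      Exec (.store a b) s (s.setMem (s.reg a) (s.reg b))
        (1 + (s.reg a).size + (s.reg b).size)
  | seq {p q : Prog} {s₁ s₂ s₃ : State} {t u : ℕ} :
      Exec p s₁ s₂ t → Exec q s₂ s₃ u → Exec (.seq p q) s₁ s₃ (t + u)
  | ifTrue {r : ℕ} {p q : Prog} {s s' : State} {t : ℕ} :
      s.reg r ≠ 0 → Exec p s s' t → Exec (.ifNZ r p q) s s' (1 + (s.reg r).size + t)
  | ifFalse {r : ℕ} {p q : Prog} {s s' : State} {t : ℕ} :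
      s.reg r = 0 → Exec q s s' t → Exec (.ifNZ r p q) s s' (1 + (s.reg r).size + t)
  | whileDone {r : ℕ} {p : Prog} {s : State} :
      s.reg r = 0 → Exec (.whileNZ r p) s s (1 + (s.reg r).size)
  | whileStep {r : ℕ} {p : Prog} {s₁ s₂ s₃ : State} {t u : ℕ} :
      s₁.reg r ≠ 0 → Exec p s₁ s₂ t → Exec (.whileNZ r p) s₂ s₃ u →
        Exec (.whileNZ r p) s₁ s₃ (1 + (s₁.reg r).size + t + u)

/-- The machine is deterministic: final state and cost are determined by the initial state. -/
theorem Exec.deterministic {p : Prog} {s s₁ : State} {t₁ : ℕ} (h₁ : Exec p s s₁ t₁) :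
    ∀ {s₂ : State} {t₂ : ℕ}, Exec p s s₂ t₂ → s₁ = s₂ ∧ t₁ = t₂ := by
  induction h₁ with
  | seq _ _ ih₁ ih₂ =>
    intro s₂ t₂ h₂
    cases h₂ with
    | seq h h' =>
      obtain ⟨rfl, rfl⟩ := ih₁ h
      obtain ⟨rfl, rfl⟩ := ih₂ h'
      exact ⟨rfl, rfl⟩
  | ifTrue hr _ ih =>
    intro s₂ t₂ h₂
    cases h₂ with
    | ifTrue _ h => obtain ⟨rfl, rfl⟩ := ih h; exact ⟨rfl, rfl⟩
    | ifFalse hr' _ => exact absurd hr' hr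
  | ifFalse hr _ ih =>
    intro s₂ t₂ h₂
    cases h₂ with
    | ifFalse _ h => obtain ⟨rfl, rfl⟩ := ih h; exact ⟨rfl, rfl⟩
    | ifTrue hr' _ => exact absurd hr hr'
  | whileDone hr =>
    intro s₂ t₂ h₂
    cases h₂ with
    | whileDone _ => exact ⟨rfl, rfl⟩
    | whileStep hr' _ _ => exact absurd hr hr'
  | whileStep hr _ _ ih₁ ih₂ =>
    intro s₂ t₂ h₂
    cases h₂ with
    | whileDone hr' => exact absurd hr' hr
    | whileStep _ h h' =>
      obtain ⟨rfl, rfl⟩ := ih₁ h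
      obtain ⟨rfl, rfl⟩ := ih₂ h'
      exact ⟨rfl, rfl⟩
  | _ => intro s₂ t₂ h₂; cases h₂; exact ⟨rfl, rfl⟩

/-- Initially the input stands in the memory cells `0, 1, …`, its length in register `0`, and all
other cells are `0`. -/
def State.init (x : List ℕ) : State where
  reg := fun r => if r = 0 then x.length else 0
  mem := fun a => x.getD a 0

/-- The size of an input: its number of entries plus their total bit length. -/
def inputSize (x : List ℕ) : ℕ := (x.map fun a => a.size + 1).sum

/-- A decision problem `P` on instances `α`, given to the machine through the encoding `enc`, is
solvable in polynomial time: one program, on every instance, halts within a time polynomial in the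
size of the encoded instance, with `1` in register `0` on yes-instances and `0` on no-instances. -/
def PolyTimeDecidable {α : Type} (enc : α → List ℕ) (P : α → Prop) : Prop :=
  ∃ (p : Prog) (q : Polynomial ℕ), ∀ x : α, ∃ (s : State) (t : ℕ),
    Exec p (State.init (enc x)) s t ∧ t ≤ q.eval (inputSize (enc x)) ∧
      (P x → s.reg 0 = 1) ∧ (¬ P x → s.reg 0 = 0)

end RAM

/-! ## Parliamentary elections -/

namespace Bribery

/-- A preference order over the parties `Fin m`, given as the bijection that sends a party to its
rank, where `0` is the most preferred rank. -/
abbrev PrefOrder (m : ℕ) : Type := Equiv.Perm (Fin m)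

/-- The position of `c` in `O`, counted from `1`. -/
def PrefOrder.pos {m : ℕ} (O : PrefOrder m) (c : Fin m) : ℕ := (O c : ℕ) + 1

/-- `x` is above `y` in `O`. -/
def PrefOrder.Above {m : ℕ} (O : PrefOrder m) (x y : Fin m) : Prop := O.pos x < O.pos y

instance {m : ℕ} (O : PrefOrder m) (x y : Fin m) : Decidable (O.Above x y) :=
  inferInstanceAs (Decidable (_ < _))

/-- The pairs `(x, y)` such that `y` is below `x` in `O` and above `x` in `O'`. -/
def PrefOrder.swapped {m : ℕ} (O O' : PrefOrder m) : Finset (Fin m × Fin m) :=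
  Finset.univ.filter fun z => O.Above z.1 z.2 ∧ O'.Above z.2 z.1

/-- The points that an order gives to a party. -/
abbrev Scoring (m : ℕ) : Type := PrefOrder m → Fin m → ℕ

def plurality (m : ℕ) : Scoring m := fun O c => if O.pos c = 1 then 1 else 0

/-- The points that the set `S` of parties gets from the orders `𝒪`. -/
def score {n m : ℕ} (γ : Scoring m) (𝒪 : Fin n → PrefOrder m) (S : Finset (Fin m)) : ℕ :=
  ∑ i, ∑ c ∈ S, γ (𝒪 i) c

/-- `c` gets at least a fraction `t` of all points. -/
def Active {n m : ℕ} (γ : Scoring m) (t : ℚ) (𝒪 : Fin n → PrefOrder m) (c : Fin m) : Prop :=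
  t * (score γ 𝒪 Finset.univ : ℚ) ≤ (score γ 𝒪 {c} : ℚ)

instance {n m : ℕ} (γ : Scoring m) (t : ℚ) (𝒪 : Fin n → PrefOrder m) (c : Fin m) :
    Decidable (Active γ t 𝒪 c) :=
  inferInstanceAs (Decidable (_ ≤ _))

/-- The fraction of seats allotted to the party `c`. -/
def seats {n m : ℕ} (γ : Scoring m) (t : ℚ) (𝒪 : Fin n → PrefOrder m) (c : Fin m) : ℚ :=
  if Active γ t 𝒪 c then
    (score γ 𝒪 {c} : ℚ) / ∑ c' ∈ Finset.univ.filter (fun c' => Active γ t 𝒪 c'), (score γ 𝒪 {c'} : ℚ)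
  else 0

/-- The fraction of seats allotted to the set `S` of parties. -/
def seatsOf {n m : ℕ} (γ : Scoring m) (t : ℚ) (𝒪 : Fin n → PrefOrder m) (S : Finset (Fin m)) : ℚ :=
  ∑ c ∈ S, seats γ t 𝒪 c

/-! ## Coalition bribery with a preferred party -/

/-- The data of an instance that do not depend on the type of bribery. -/
structure CBPData where
  /-- number of voters -/
  n : ℕ
  /-- number of parties -/
  m : ℕ
  n_pos : 0 < n
  order : Fin n → PrefOrder m
  coalition : Finset (Fin m)
  preferred : Fin m
  preferred_mem : preferred ∈ coalition
  budget : ℕ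
  /-- target support -/
  φ : ℚ
  φ_nonneg : 0 ≤ φ
  φ_le_one : φ ≤ 1
  /-- target ratio -/
  ρ : ℚ
  ρ_nonneg : 0 ≤ ρ
  ρ_le_one : ρ ≤ 1

/-- There is a successful bribe, for the scoring function `γ`, the threshold `t`, and the type of
bribery with permissible new orders `perm i` and prices `π i` for the voter `i`. -/
def CBPData.HasBribe (I : CBPData) (γ : Scoring I.m) (t : ℚ)
    (perm : Fin I.n → PrefOrder I.m → Prop) (π : Fin I.n → PrefOrder I.m → ℕ) : Prop :=
  ∃ 𝒪' : Fin I.n → PrefOrder I.m,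
    (∀ i, perm i (𝒪' i)) ∧
    ∑ i, π i (𝒪' i) ≤ I.budget ∧
    I.φ * seatsOf γ t 𝒪' Finset.univ ≤ seatsOf γ t 𝒪' I.coalition ∧
    I.ρ * seatsOf γ t 𝒪' I.coalition ≤ seats γ t 𝒪' I.preferred

/-- An instance for swap-bribery: `sw i x y` is the price of moving `y` from below `x` to above
`x` in the order of the voter `i`. -/
structure SwapInstance extends CBPData where
  sw : Fin n → Fin m → Fin m → ℕ

def SwapInstance.price (I : SwapInstance) (i : Fin I.n) (O' : PrefOrder I.m) : ℕ :=
  ∑ z ∈ (I.order i).swapped O', I.sw i z.1 z.2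

/-- Plurality CBP without threshold, for swap-bribery. -/
def SwapInstance.PluralityCBP (I : SwapInstance) : Prop :=
  I.HasBribe (plurality I.m) 0 (fun _ _ => True) I.price

/-- An instance for coalition-shift-bribery: `s i k` is the price of a change of the order of the
voter `i` in which `k` pairs of parties are swapped. -/
structure ShiftInstance extends CBPData where
  s : Fin n → ℕ → ℕ
  s_mono : ∀ i, Monotone (s i)

/-- No member of the coalition may fall from above to below a party outside the coalition. -/
def ShiftInstance.Permissible (I : ShiftInstance) (i : Fin I.n) (O' : PrefOrder I.m) : Prop :=
  ∀ x ∈ I.coalition, ∀ y ∉ I.coalition, (I.order i).Above x y → O'.Above x y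

def ShiftInstance.price (I : ShiftInstance) (i : Fin I.n) (O' : PrefOrder I.m) : ℕ :=
  I.s i ((I.order i).swapped O').card

/-- Plurality CBP without threshold, for coalition-shift-bribery. -/
def ShiftInstance.PluralityCBP (I : ShiftInstance) : Prop :=
  I.HasBribe (plurality I.m) 0 I.Permissible I.price

/-! ## Encoding of the instances as lists of natural numbers -/

/-- Numbers of voters and parties, preferred party, budget, numerators and denominators of the
targets, the indicator of the coalition, and for each voter the list of the ranks of the parties. -/
def CBPData.encode (I : CBPData) : List ℕ :=
  [I.n, I.m, (I.preferred : ℕ), I.budget, I.φ.num.toNat, I.φ.den, I.ρ.num.toNat, I.ρ.den] ++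
  List.ofFn (fun c : Fin I.m => if c ∈ I.coalition then 1 else 0) ++
  (List.ofFn fun i : Fin I.n => List.ofFn fun c : Fin I.m => (I.order i c : ℕ)).flatten

/-- The swap prices are listed as one matrix for each voter. -/
def SwapInstance.encode (I : SwapInstance) : List ℕ :=
  I.toCBPData.encode ++
  (List.ofFn fun i : Fin I.n =>
    (List.ofFn fun x : Fin I.m => List.ofFn fun y : Fin I.m => I.sw i x y).flatten).flatten

/-- The price function of each voter is listed by its values at `0, …, m.choose 2`, all the numbers
of swapped pairs that can occur. -/
def ShiftInstance.encode (I : ShiftInstance) : List ℕ :=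
  I.toCBPData.encode ++
  (List.ofFn fun i : Fin I.n => (List.range (I.m.choose 2 + 1)).map (I.s i)).flatten

end Bribery

namespace RAM

/-! ## A language of bounded loops -/

/-- A machine state whose registers are named by `V`. -/
structure Store (V : Type) where
  reg : V → ℕ
  mem : ℕ → ℕ

/-- Programs without multiplication whose loops are bounded by read-only parameters:
`loop i p` runs `p` as many times as the `i`-th parameter says. -/
inductive Code (V : Type) where
  | const (d : V) (k : ℕ)
  | param (d : V) (i : ℕ)
  | move (d a : V)
  | add (d a b : V)
  | sub (d a b : V)
  | load (d a : V)
  | store (a b : V)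
  | seq (p q : Code V)
  | ifNZ (r : V) (p q : Code V)
  | loop (i : ℕ) (p : Code V)

namespace Code

notation:60 p:61 ";;" q:60 => Code.seq p q

variable {V : Type}

section Semantics

variable [DecidableEq V]

/-- The state that a program reaches, for the parameters `P`. -/
def eval (P : ℕ → ℕ) : Code V → Store V → Store V
  | const d k, s => { s with reg := Function.update s.reg d k }
  | param d i, s => { s with reg := Function.update s.reg d (P i) }
  | move d a, s => { s with reg := Function.update s.reg d (s.reg a) }
  | add d a b, s => { s with reg := Function.update s.reg d (s.reg a + s.reg b) }
  | sub d a b, s => { s with reg := Function.update s.reg d (s.reg a - s.reg b) }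
  | load d a, s => { s with reg := Function.update s.reg d (s.mem (s.reg a)) }
  | store a b, s => { s with mem := Function.update s.mem (s.reg a) (s.reg b) }
  | seq p q, s => q.eval P (p.eval P s)
  | ifNZ r p q, s => if s.reg r = 0 then q.eval P s else p.eval P s
  | loop i p, s => (p.eval P)^[P i] s

/-- The registers that a program may change. -/
def writes : Code V → List V
  | const d _ | param d _ | move d _ | add d _ _ | sub d _ _ | load d _ => [d]
  | store _ _ => []
  | seq p q | ifNZ _ p q => p.writes ++ q.writes
  | loop _ p => p.writes

/-- The program does not change the memory. -/
def storeFree : Code V → Bool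
  | store _ _ => false
  | seq p q | ifNZ _ p q => p.storeFree && q.storeFree
  | loop _ p => p.storeFree
  | _ => true

theorem eval_loop_induction {P : ℕ → ℕ} {i : ℕ} {p : Code V} {s : Store V}
    (Inv : ℕ → Store V → Prop) (h0 : Inv 0 s)
    (hs : ∀ t s, t < P i → Inv t s → Inv (t + 1) (p.eval P s)) :
    Inv (P i) ((loop i p).eval P s) := by
  have key : ∀ t, t ≤ P i → Inv t ((p.eval P)^[t] s) := by
    intro t
    induction t with
    | zero => intro _; exact h0
    | succ t ih =>
      intro ht
      rw [Function.iterate_succ_apply']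
      exact hs _ _ (by omega) (ih (by omega))
  exact key _ le_rfl

theorem eval_reg_of_notMem (P : ℕ → ℕ) {v : V} :
    ∀ {p : Code V} {s : Store V}, v ∉ p.writes → (p.eval P s).reg v = s.reg v
  | const .., s, h | param .., s, h | move .., s, h | add .., s, h | sub .., s, h
  | load .., s, h => by
    simp only [writes, List.mem_singleton] at h
    simp [eval, Function.update_of_ne h]
  | store .., s, _ => rfl
  | seq p q, s, h => by
    simp only [writes, List.mem_append, not_or] at h
    rw [eval, eval_reg_of_notMem P h.2, eval_reg_of_notMem P h.1]
  | ifNZ r p q, s, h => by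
    simp only [writes, List.mem_append, not_or] at h
    rw [eval]
    split
    · exact eval_reg_of_notMem P h.2
    · exact eval_reg_of_notMem P h.1
  | loop i p, s, h => by
    refine eval_loop_induction (fun _ s' => s'.reg v = s.reg v) rfl fun t s' _ hs' => ?_
    rw [eval_reg_of_notMem P (by simpa [writes] using h), hs']

theorem eval_mem_of_storeFree (P : ℕ → ℕ) :
    ∀ {p : Code V} {s : Store V}, p.storeFree = true → (p.eval P s).mem = s.mem
  | const .., s, _ | param .., s, _ | move .., s, _ | add .., s, _ | sub .., s, _
  | load .., s, _ => rfl
  | store .., s, h => by simp [storeFree] at h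
  | seq p q, s, h => by
    simp only [storeFree, Bool.and_eq_true] at h
    rw [eval, eval_mem_of_storeFree P h.2, eval_mem_of_storeFree P h.1]
  | ifNZ r p q, s, h => by
    simp only [storeFree, Bool.and_eq_true] at h
    rw [eval]
    split
    · exact eval_mem_of_storeFree P h.2
    · exact eval_mem_of_storeFree P h.1
  | loop i p, s, h => by
    refine eval_loop_induction (fun _ s' => s'.mem = s.mem) rfl fun t s' _ hs' => ?_
    rw [eval_mem_of_storeFree P (by simpa [storeFree] using h), hs']

end Semantics

/-! ### Compilation -/

open Polynomial in
/-- A bound for the number of executed instructions, as a polynomial in a bound for the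
parameters. -/
noncomputable def steps : Code V → ℕ[X]
  | const _ k => C (1 + k.size)
  | seq p q => p.steps + q.steps
  | ifNZ _ p q => 1 + p.steps + q.steps
  | loop _ p => 2 + X * (p.steps + 2)
  | _ => 1

/-- Translation into machine programs. The register `v` becomes `3 * ix v`, the parameter `i`
becomes `3 * i + 1`, and `3 * k + 2` is the counter of the loops at depth `k`. The parameter `0`
has to be `1`. -/
def compile (ix : V → ℕ) (k : ℕ) : Code V → Prog
  | const d n => .const (3 * ix d) n
  | param d i => .move (3 * ix d) (3 * i + 1)
  | move d a => .move (3 * ix d) (3 * ix a)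
  | add d a b => .add (3 * ix d) (3 * ix a) (3 * ix b)
  | sub d a b => .sub (3 * ix d) (3 * ix a) (3 * ix b)
  | load d a => .load (3 * ix d) (3 * ix a)
  | store a b => .store (3 * ix a) (3 * ix b)
  | seq p q => .seq (p.compile ix k) (q.compile ix k)
  | ifNZ r p q => .ifNZ (3 * ix r) (p.compile ix k) (q.compile ix k)
  | loop i p => .seq (.move (3 * k + 2) (3 * i + 1))
      (.whileNZ (3 * k + 2) (.seq (p.compile ix (k + 1)) (.sub (3 * k + 2) (3 * k + 2) 1)))

end Code

/-- All numbers in the state have at most `z` bits. -/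
def State.Bounded (σ : State) (z : ℕ) : Prop :=
  (∀ r, σ.reg r < 2 ^ z) ∧ ∀ a, σ.mem a < 2 ^ z

theorem State.Bounded.mono {σ : State} {z z' : ℕ} (h : σ.Bounded z) (hz : z ≤ z') :
    σ.Bounded z' :=
  have hp : 2 ^ z ≤ 2 ^ z' := Nat.pow_le_pow_right (by norm_num) hz
  ⟨fun r => (h.1 r).trans_le hp, fun a => (h.2 a).trans_le hp⟩

theorem State.reg_setReg_of_ne (σ : State) {r d : ℕ} (v : ℕ) (h : r ≠ d) :
    (σ.setReg d v).reg r = σ.reg r := Function.update_of_ne h _ _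

theorem State.Bounded.setReg {σ : State} {z v : ℕ} (h : σ.Bounded z) (d : ℕ) (hv : v < 2 ^ z) :
    (σ.setReg d v).Bounded z := by
  refine ⟨fun r => ?_, h.2⟩
  simp only [State.setReg, Function.update_apply]
  split
  · exact hv
  · exact h.1 r

theorem State.Bounded.setMem {σ : State} {z v : ℕ} (h : σ.Bounded z) (a : ℕ) (hv : v < 2 ^ z) :
    (σ.setMem a v).Bounded z := by
  refine ⟨h.1, fun r => ?_⟩
  simp only [State.setMem, Function.update_apply]
  split
  · exact hv
  · exact h.2 r

theorem State.Bounded.size_reg {σ : State} {z : ℕ} (h : σ.Bounded z) (r : ℕ) :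
    (σ.reg r).size ≤ z := Nat.size_le.2 (h.1 r)

theorem State.Bounded.size_mem {σ : State} {z : ℕ} (h : σ.Bounded z) (a : ℕ) :
    (σ.mem a).size ≤ z := Nat.size_le.2 (h.2 a)

/-- The machine state `σ` holds the parameters `P` and the store `s`. -/
structure State.Represents {V : Type} (ix : V → ℕ) (P : ℕ → ℕ) (s : Store V) (σ : State) :
    Prop where
  reg : ∀ v, σ.reg (3 * ix v) = s.reg v
  param : ∀ i, σ.reg (3 * i + 1) = P i
  mem : σ.mem = s.mem

theorem State.Represents.setReg {V : Type} [DecidableEq V] {ix : V → ℕ} (hix : ix.Injective)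
    {P : ℕ → ℕ} {s : Store V} {σ : State} (h : σ.Represents ix P s) (d : V) (v : ℕ) :
    (σ.setReg (3 * ix d) v).Represents ix P { s with reg := Function.update s.reg d v } := by
  refine ⟨fun x => ?_, fun i => ?_, h.mem⟩
  · by_cases hx : x = d
    · subst hx; simp [State.setReg]
    · have : ix x ≠ ix d := fun e => hx (hix e)
      simp [State.setReg, hx, this, h.reg]
  · rw [State.reg_setReg_of_ne _ _ (by omega), h.param]

theorem State.Represents.setCounter {V : Type} {ix : V → ℕ}
    {P : ℕ → ℕ} {s : Store V} {σ : State} (h : σ.Represents ix P s) (k v : ℕ) :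
    (σ.setReg (3 * k + 2) v).Represents ix P s := by
  refine ⟨fun x => ?_, fun i => ?_, h.mem⟩
  · rw [State.reg_setReg_of_ne _ _ (by omega), h.reg]
  · rw [State.reg_setReg_of_ne _ _ (by omega), h.param]

theorem Code.exec_compile {V : Type} [DecidableEq V] {ix : V → ℕ} (hix : ix.Injective)
    {P : ℕ → ℕ} (hP0 : P 0 = 1) {M : ℕ} (hM : ∀ i, P i ≤ M) (c : Code V) :
    ∀ (k : ℕ) (s : Store V) (σ : State) (z : ℕ), σ.Represents ix P s → σ.Bounded z →
      ∃ (σ' : State) (t : ℕ), Exec (c.compile ix k) σ σ' t ∧ σ'.Represents ix P (c.eval P s) ∧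
        σ'.Bounded (z + c.steps.eval M) ∧
        (∀ j < k, σ'.reg (3 * j + 2) = σ.reg (3 * j + 2)) ∧
        t ≤ c.steps.eval M * (1 + 2 * (z + c.steps.eval M)) := by
  have hcnt : ∀ (σ : State) (k d v : ℕ), ∀ j < k,
      (σ.setReg (3 * d) v).reg (3 * j + 2) = σ.reg (3 * j + 2) := by
    intro σ k d v j _
    exact State.reg_setReg_of_ne _ _ (by omega)
  induction c with
  | const d n =>
    intro k s σ z hr hb
    refine ⟨_, _, .const _ _ _, hr.setReg hix _ _, ?_, hcnt _ _ _ _, ?_⟩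
    · refine (hb.mono (by omega)).setReg _ (Nat.size_le.1 ?_)
      simp [steps]; omega
    · simp only [steps, Polynomial.eval_C]
      nlinarith [Nat.zero_le (n.size)]
  | param d i =>
    intro k s σ z hr hb
    refine ⟨_, _, .move _ _ _, ?_, ?_, hcnt _ _ _ _, ?_⟩
    · rw [hr.param]; exact hr.setReg hix _ _
    · exact (hb.setReg _ (hb.1 _)).mono (by omega)
    · have := hb.size_reg (3 * i + 1)
      simp [steps]; omega
  | move d a =>
    intro k s σ z hr hb
    refine ⟨_, _, .move _ _ _, ?_, ?_, hcnt _ _ _ _, ?_⟩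
    · rw [hr.reg]; exact hr.setReg hix _ _
    · exact (hb.setReg _ (hb.1 _)).mono (by omega)
    · have := hb.size_reg (3 * ix a)
      simp [steps]; omega
  | add d a b =>
    intro k s σ z hr hb
    refine ⟨_, _, .add _ _ _ _, ?_, ?_, hcnt _ _ _ _, ?_⟩
    · rw [hr.reg, hr.reg]; exact hr.setReg hix _ _
    · refine (hb.mono (by omega)).setReg _ ?_
      have h1 := hb.1 (3 * ix a)
      have h2 := hb.1 (3 * ix b)
      simp only [steps, Polynomial.eval_one, pow_succ]; omega
    · have := hb.size_reg (3 * ix a)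
      have := hb.size_reg (3 * ix b)
      simp [steps]; omega
  | sub d a b =>
    intro k s σ z hr hb
    refine ⟨_, _, .sub _ _ _ _, ?_, ?_, hcnt _ _ _ _, ?_⟩
    · rw [hr.reg, hr.reg]; exact hr.setReg hix _ _
    · exact (hb.setReg _ ((Nat.sub_le _ _).trans_lt (hb.1 _))).mono (by omega)
    · have := hb.size_reg (3 * ix a)
      have := hb.size_reg (3 * ix b)
      simp [steps]; omega
  | load d a =>
    intro k s σ z hr hb
    refine ⟨_, _, .load _ _ _, ?_, ?_, hcnt _ _ _ _, ?_⟩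
    · rw [hr.reg, hr.mem]; exact hr.setReg hix _ _
    · exact (hb.setReg _ (hb.2 _)).mono (by omega)
    · have := hb.size_reg (3 * ix a)
      have := hb.size_mem (σ.reg (3 * ix a))
      simp [steps]; omega
  | store a b =>
    intro k s σ z hr hb
    refine ⟨_, _, .store _ _ _, ?_, ?_, fun _ _ => rfl, ?_⟩
    · refine ⟨hr.reg, hr.param, ?_⟩
      simp [State.setMem, eval, hr.reg, hr.mem]
    · exact (hb.setMem _ (hb.1 _)).mono (by omega)
    · have := hb.size_reg (3 * ix a)
      have := hb.size_reg (3 * ix b)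
      simp [steps]; omega
  | seq p q ihp ihq =>
    intro k s σ z hr hb
    obtain ⟨σ₁, t₁, he₁, hr₁, hb₁, hc₁, ht₁⟩ := ihp k s σ z hr hb
    obtain ⟨σ₂, t₂, he₂, hr₂, hb₂, hc₂, ht₂⟩ := ihq k _ σ₁ _ hr₁ hb₁
    refine ⟨σ₂, _, he₁.seq he₂, hr₂, ?_, fun j hj => (hc₂ j hj).trans (hc₁ j hj), ?_⟩
    · simpa [steps, add_assoc] using hb₂
    · simp only [steps, Polynomial.eval_add]
      calc t₁ + t₂ ≤ _ := add_le_add ht₁ ht₂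
        _ ≤ _ := by
          rw [add_mul, add_assoc z]
          gcongr
          omega
  | ifNZ r p q ihp ihq =>
    intro k s σ z hr hb
    have hs := hb.size_reg (3 * ix r)
    by_cases h0 : s.reg r = 0
    · obtain ⟨σ₂, t₂, he₂, hr₂, hb₂, hc₂, ht₂⟩ := ihq k s σ z hr hb
      refine ⟨σ₂, _, .ifFalse (by rw [hr.reg, h0]) he₂, by simpa [eval, h0] using hr₂,
        hb₂.mono ?_, hc₂, ?_⟩
      · simp [steps]
      · simp only [steps, Polynomial.eval_add, Polynomial.eval_one]
        have : q.steps.eval M * (1 + 2 * (z + q.steps.eval M)) ≤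
          q.steps.eval M * (1 + 2 * (z + (1 + p.steps.eval M + q.steps.eval M))) := by
          gcongr; omega
        rw [add_mul, add_mul]
        omega
    · obtain ⟨σ₂, t₂, he₂, hr₂, hb₂, hc₂, ht₂⟩ := ihp k s σ z hr hb
      refine ⟨σ₂, _, .ifTrue (by rwa [hr.reg]) he₂, by simpa [eval, h0] using hr₂,
        hb₂.mono ?_, hc₂, ?_⟩
      · simp [steps]; omega
      · simp only [steps, Polynomial.eval_add, Polynomial.eval_one]
        have : p.steps.eval M * (1 + 2 * (z + p.steps.eval M)) ≤
          p.steps.eval M * (1 + 2 * (z + (1 + p.steps.eval M + q.steps.eval M))) := by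
          gcongr; omega
        rw [add_mul, add_mul]
        omega
  | loop i p ih =>
    intro k s σ z hr hb
    set T := p.steps.eval M with hT
    have key : ∀ (Z n : ℕ) (s : Store V) (σ : State) (z : ℕ), σ.Represents ix P s →
        σ.Bounded z → σ.reg (3 * k + 2) = n → z + n * (T + 2) ≤ Z →
        ∃ (σ' : State) (t : ℕ), Exec (.whileNZ (3 * k + 2)
            (.seq (p.compile ix (k + 1)) (.sub (3 * k + 2) (3 * k + 2) 1))) σ σ' t ∧
          σ'.Represents ix P ((p.eval P)^[n] s) ∧ σ'.Bounded (z + n * (T + 2)) ∧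
          (∀ j < k, σ'.reg (3 * j + 2) = σ.reg (3 * j + 2)) ∧
          t ≤ (n * (T + 2) + 1) * (1 + 2 * Z) := by
      intro Z n
      induction n with
      | zero =>
        intro s σ z hr hb hn hz
        have := hb.size_reg (3 * k + 2)
        refine ⟨σ, _, .whileDone hn, hr, by simpa using hb, fun _ _ => rfl, ?_⟩
        simp only [zero_mul, zero_add, one_mul]; omega
      | succ n ihn =>
        intro s σ z hr hb hn hz
        have e : z + (n + 1) * (T + 2) = z + T + 2 + n * (T + 2) := by ring
        obtain ⟨σ₁, t₁, he₁, hr₁, hb₁, hc₁, ht₁⟩ := ih (k + 1) s σ z hr hb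
        have hk : σ₁.reg (3 * k + 2) = n + 1 := by rw [hc₁ k (by omega), hn]
        have h1 : σ₁.reg 1 = 1 := (hr₁.param 0).trans hP0
        obtain ⟨σ₂, t₂, he₂, hr₂, hb₂, hc₂, ht₂⟩ := ihn _ _ (z + T + 2)
          (hr₁.setCounter k (σ₁.reg (3 * k + 2) - σ₁.reg 1))
          ((hb₁.mono (by omega)).setReg _ ((Nat.sub_le _ _).trans_lt
            ((hb₁.mono (by omega)).1 _)))
          (by simp [State.setReg, hk, h1]) (by omega)
        refine ⟨σ₂, _, .whileStep (by omega) (he₁.seq (.sub _ _ _ _)) he₂, hr₂,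
          hb₂.mono e.ge, fun j hj => ?_, ?_⟩
        · rw [hc₂ j hj, State.reg_setReg_of_ne _ _ (by omega), hc₁ j (by omega)]
        · have g1 := hb.size_reg (3 * k + 2)
          have g2 := hb₁.size_reg (3 * k + 2)
          have g3 := hb₁.size_reg 1
          have g4 : t₁ ≤ T * (1 + 2 * Z) := ht₁.trans (by gcongr; omega)
          have e2 : ((n + 1) * (T + 2) + 1) * (1 + 2 * Z) =
            (1 + 2 * Z) + (T * (1 + 2 * Z) + (1 + 2 * Z)) + (n * (T + 2) + 1) * (1 + 2 * Z) := by
            ring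
          rw [e2]
          omega
    have hst : (loop i p).steps.eval M = 2 + M * (T + 2) := by simp [steps, hT]
    have hle : P i * (T + 2) ≤ M * (T + 2) := by gcongr; exact hM i
    obtain ⟨σ', t, he, hr', hb', hc, ht⟩ := key (z + P i * (T + 2)) (P i) s
      (σ.setReg (3 * k + 2) (σ.reg (3 * i + 1))) z (hr.setCounter _ _) (hb.setReg _ (hb.1 _))
      (by simp [State.setReg, hr.param]) le_rfl
    refine ⟨σ', _, .seq (.move _ _ _) he, hr', hb'.mono (by rw [hst]; omega), fun j hj => ?_, ?_⟩
    · rw [hc j hj, State.reg_setReg_of_ne _ _ (by omega)]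
    · have g1 := hb.size_reg (3 * i + 1)
      rw [hst]
      calc _ ≤ (1 + 2 * (z + P i * (T + 2))) +
              (P i * (T + 2) + 1) * (1 + 2 * (z + P i * (T + 2))) := by omega
        _ = (2 + P i * (T + 2)) * (1 + 2 * (z + P i * (T + 2))) := by ring
        _ ≤ _ := by
          gcongr
          omega

/-! ### A criterion for polynomial time -/

/-- The parameters that a program gets from the input: `1`, the first two entries of the input,
and the successor of the first one. -/
def inputParam (x : List ℕ) : ℕ → ℕ
  | 0 => 1
  | 1 => x.getD 0 0
  | 2 => x.getD 1 0
  | 3 => x.getD 0 0 + 1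
  | _ => 0

/-- The initial store: the input is in the memory, its length in the register `out`. -/
def Store.init {V : Type} [DecidableEq V] (out : V) (x : List ℕ) : Store V where
  reg := fun v => if v = out then x.length else 0
  mem := fun a => x.getD a 0

theorem length_le_inputSize (x : List ℕ) : x.length ≤ inputSize x := by
  induction x with
  | nil => simp
  | cons a x ih => simp only [inputSize, List.map_cons, List.sum_cons, List.length_cons] at *; omega

theorem size_getD_le_inputSize (x : List ℕ) (a : ℕ) : (x.getD a 0).size ≤ inputSize x := by
  induction x generalizing a with
  | nil => simp
  | cons b x ih =>
    simp only [inputSize, List.map_cons, List.sum_cons] at *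
    cases a with
    | zero => simp; omega
    | succ a => have := ih a; simp only [List.getD_cons_succ]; omega

theorem PolyTimeDecidable.of_code {V : Type} [DecidableEq V] {ix : V → ℕ} (hix : ix.Injective)
    {out : V} (hout : ix out = 0) {α : Type} {enc : α → List ℕ} {Q : α → Prop} (c : Code V)
    (h0 : ∀ x, (enc x).getD 0 0 < (enc x).length) (h1 : ∀ x, (enc x).getD 1 0 ≤ (enc x).length)
    (hyes : ∀ x, Q x → (c.eval (inputParam (enc x)) (Store.init out (enc x))).reg out = 1)
    (hno : ∀ x, ¬ Q x → (c.eval (inputParam (enc x)) (Store.init out (enc x))).reg out = 0) :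
    PolyTimeDecidable enc Q := by
  refine ⟨.seq (.const 1 1) (.seq (.load 4 2) (.seq (.load 7 1) (.seq (.add 10 4 1)
    (c.compile ix 0)))),
    (5 + 4 * (Polynomial.X + 1)) + (2 + 2 * Polynomial.X) +
      c.steps * (1 + 2 * (Polynomial.X + 1 + c.steps)), fun x => ?_⟩
  set l := enc x with hl
  set z := inputSize l with hz
  have hlen := length_le_inputSize l
  have hn : l.getD 0 0 < l.length := h0 x
  have hm : l.getD 1 0 ≤ l.length := h1 x
  have hpos : 0 < z := by omega
  have hzz : z < 2 ^ z := Nat.lt_two_pow_self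
  have hb0 : (State.init l).Bounded z := by
    refine ⟨fun r => ?_, fun a => Nat.size_le.1 (size_getD_le_inputSize l a)⟩
    simp only [State.init]
    split <;> omega
  set σ₁ := (State.init l).setReg 1 1 with hσ₁
  have hb1 : σ₁.Bounded z := hb0.setReg _ (by omega)
  have v2 : σ₁.reg 2 = 0 := by simp [hσ₁, State.setReg, State.init]
  set σ₂ := σ₁.setReg 4 (σ₁.mem (σ₁.reg 2)) with hσ₂
  have hb2 : σ₂.Bounded z := hb1.setReg _ (hb1.2 _)
  set σ₃ := σ₂.setReg 7 (σ₂.mem (σ₂.reg 1)) with hσ₃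
  have hb3 : σ₃.Bounded z := hb2.setReg _ (hb2.2 _)
  set σ₄ := σ₃.setReg 10 (σ₃.reg 4 + σ₃.reg 1) with hσ₄
  have hb4 : σ₄.Bounded (z + 1) := by
    refine (hb3.mono (by omega)).setReg _ ?_
    have := hb3.1 4
    have := hb3.1 1
    rw [pow_succ]; omega
  have hr : σ₄.Represents ix (inputParam l) (Store.init out l) := by
    refine ⟨fun v => ?_, fun i => ?_, rfl⟩
    · have e : ix v = 0 ↔ v = out := by rw [← hout]; exact hix.eq_iff
      rw [State.reg_setReg_of_ne _ _ (by omega), State.reg_setReg_of_ne _ _ (by omega),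
        State.reg_setReg_of_ne _ _ (by omega), State.reg_setReg_of_ne _ _ (by omega)]
      simp [State.init, Store.init, e]
    · rcases i with _ | _ | _ | _ | i
      case succ.succ.succ.succ =>
        rw [State.reg_setReg_of_ne _ _ (by omega), State.reg_setReg_of_ne _ _ (by omega),
          State.reg_setReg_of_ne _ _ (by omega), State.reg_setReg_of_ne _ _ (by omega)]
        rfl
      all_goals
        simp [hσ₄, hσ₃, hσ₂, hσ₁, State.setReg, State.init, inputParam]
  have hM : ∀ i, inputParam l i ≤ z := by
    intro i
    rcases i with _ | _ | _ | _ | i <;> simp only [inputParam] <;> omega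
  obtain ⟨σ', t, he, hr', -, -, ht⟩ := c.exec_compile hix rfl hM 0 _ _ _ hr hb4
  have he₁ : Exec (.const 1 1) (State.init l) σ₁ _ := .const _ _ _
  have he₂ : Exec (.load 4 2) σ₁ σ₂ _ := .load _ _ _
  have he₃ : Exec (.load 7 1) σ₂ σ₃ _ := .load _ _ _
  have he₄ : Exec (.add 10 4 1) σ₃ σ₄ _ := .add _ _ _ _
  refine ⟨σ', _, he₁.seq (he₂.seq (he₃.seq (he₄.seq he))), ?_, fun hQ => ?_, fun hQ => ?_⟩
  · have g1 := hb1.size_reg 2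
    have g2 := hb1.size_mem (σ₁.reg 2)
    have g3 := hb2.size_reg 1
    have g4 := hb2.size_mem (σ₂.reg 1)
    have g5 := hb3.size_reg 4
    have g6 := hb3.size_reg 1
    have g7 : Nat.size 1 = 1 := by simp
    simp only [Polynomial.eval_add, Polynomial.eval_mul, Polynomial.eval_X, Polynomial.eval_one,
      Polynomial.eval_ofNat]
    omega
  · have := hr'.reg out
    rw [hout] at this
    exact this.trans (hyes x hQ)
  · have := hr'.reg out
    rw [hout] at this
    exact this.trans (hno x hQ)

end RAM

namespace Bribery

/-! ## Dynamic program -/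

/-- One stage of the dynamic program, restricted to the first `c` parties: from the table `D`
of the earlier voters, choosing the party `x` costs `w x` and moves the index by `off x`. -/
def dpStage (D w off : ℕ → ℕ) : ℕ → ℕ → ℕ
  | 0, _ => 0
  | c + 1, j => max (dpStage D w off c j) (if off c ≤ j then D (j - off c) - w c else 0)

/-- `dpTable B m w off i j` is one more than the largest remaining budget with which the first `i`
voters can reach the index `j`, and `0` if they cannot. -/
def dpTable (B m : ℕ) (w : ℕ → ℕ → ℕ) (off : ℕ → ℕ) : ℕ → ℕ → ℕ
  | 0, j => if j = 0 then B + 1 else 0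
  | i + 1, j => dpStage (dpTable B m w off i) (w i) off m j

theorem lt_dpStage_iff {D w off : ℕ → ℕ} {c j v : ℕ} :
    v < dpStage D w off c j ↔ ∃ x < c, off x ≤ j ∧ v + w x < D (j - off x) := by
  induction c with
  | zero => simp [dpStage]
  | succ c ih =>
    rw [dpStage, lt_max_iff, ih]
    constructor
    · rintro (⟨x, hx, h⟩ | h)
      · exact ⟨x, by omega, h⟩
      · split_ifs at h with hc
        · exact ⟨c, by omega, hc, by omega⟩
        · omega
    · rintro ⟨x, hx, hj, h⟩
      obtain rfl | hx' := (Nat.lt_succ_iff.1 hx).eq_or_lt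
      · right; rw [if_pos hj]; omega
      · exact .inl ⟨x, hx', hj, h⟩

theorem lt_dpTable_iff {B m : ℕ} {w : ℕ → ℕ → ℕ} {off : ℕ → ℕ} {i j v : ℕ} :
    v < dpTable B m w off i j ↔ ∃ f : ℕ → ℕ, (∀ x < i, f x < m) ∧
      ∑ x ∈ Finset.range i, off (f x) = j ∧ v + ∑ x ∈ Finset.range i, w x (f x) ≤ B := by
  induction i generalizing j v with
  | zero =>
    simp only [dpTable, Finset.range_zero, Finset.sum_empty]
    constructor
    · intro h
      split_ifs at h with hj
      · exact ⟨fun _ => 0, by simp, hj.symm, by omega⟩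
      · omega
    · rintro ⟨_, _, hj, h⟩
      rw [if_pos hj.symm]; omega
  | succ i ih =>
    rw [dpTable, lt_dpStage_iff]
    constructor
    · rintro ⟨c, hc, hj, h⟩
      obtain ⟨f, hf, hs, hv⟩ := ih.1 h
      have hne : ∀ x ∈ Finset.range i, Function.update f i c x = f x := fun x hx =>
        Function.update_of_ne (Finset.mem_range.1 hx).ne _ _
      refine ⟨Function.update f i c, fun x hx => ?_, ?_, ?_⟩
      · by_cases hxi : x = i
        · subst hxi; simpa using hc
        · rw [Function.update_of_ne hxi]; exact hf x (by omega)
      · rw [Finset.sum_range_succ, Finset.sum_congr rfl fun x hx => by rw [hne x hx], hs]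
        simp; omega
      · rw [Finset.sum_range_succ, Finset.sum_congr rfl fun x hx => by rw [hne x hx]]
        simp; omega
    · rintro ⟨f, hf, hs, hv⟩
      rw [Finset.sum_range_succ] at hs hv
      exact ⟨f i, hf i (by omega), by omega,
        ih.2 ⟨f, fun x hx => hf x (by omega), by omega, by omega⟩⟩

theorem dpTable_eq_zero {B m W : ℕ} {w : ℕ → ℕ → ℕ} {off : ℕ → ℕ} (hoff : ∀ c < m, off c ≤ W)
    {i j : ℕ} (hj : i * W < j) : dpTable B m w off i j = 0 := by
  by_contra h
  obtain ⟨f, hf, hs, -⟩ := lt_dpTable_iff.1 (Nat.pos_of_ne_zero h)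
  have : ∑ x ∈ Finset.range i, off (f x) ≤ ∑ x ∈ Finset.range i, W :=
    Finset.sum_le_sum fun x hx => hoff _ (hf x (Finset.mem_range.1 hx))
  rw [Finset.sum_const, Finset.card_range, smul_eq_mul] at this
  omega

/-! ## The program -/

open RAM Code

/-- The registers of the program. At the start `out` holds the length of the input. -/
inductive Var
  | out | one | eight | parties | width | pref | cap | size | stride
  | cur | rankRow | priceRow | party | bit | off | cost | src | dst | val | tmp | ptr | rank
  | supNum | supDen | ratNum | ratDen | need | supK | supL | ratK | ratL | prefK
  deriving DecidableEq

theorem Var.ctorIdx_injective : Function.Injective Var.ctorIdx := by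
  intro a b h
  cases a <;> cases b <;> first | rfl | exact absurd h (by decide)

namespace Program

open Var

/-- Reads the parameters of the instance and initializes the table; `str` computes the number of
price entries of a voter. -/
def setup (str : Code Var) : Code Var :=
  const one 1 ;; param parties 2 ;; param width 3 ;; const eight 8 ;;
  const tmp 2 ;; load pref tmp ;; const tmp 3 ;; load cap tmp ;; add cap cap one ;;
  loop 3 (add size size width) ;;
  add rankRow eight parties ;; move priceRow rankRow ;; loop 1 (add priceRow priceRow parties) ;;
  str ;; move cur out ;; store cur cap

/-- Membership in the coalition and index shift of the current party. -/
def prepare : Code Var :=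
  add tmp eight party ;; load bit tmp ;; sub tmp party pref ;; sub val pref party ;;
  add tmp tmp val ;; ifNZ tmp (move off bit) (move off width) ;; const cost 0

/-- Transition from one cell of the table, for the current voter and party. -/
def push : Code Var :=
  load val src ;; sub val val cost ;; add dst src size ;; add dst dst off ;; load tmp dst ;;
  sub val val tmp ;; add tmp tmp val ;; store dst tmp ;; add src src one

def pushRow : Code Var := move src cur ;; loop 3 (loop 3 push)

def partyStep (wb : Code Var) : Code Var :=
  prepare ;; wb ;; pushRow ;; add party party one

def voterStep (wb : Code Var) : Code Var :=
  const party 0 ;; loop 2 (partyStep wb) ;;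
  add rankRow rankRow parties ;; add priceRow priceRow stride ;; add cur cur size

/-- Reads the targets. -/
def targets : Code Var :=
  const tmp 4 ;; load supNum tmp ;; const tmp 5 ;; load supDen tmp ;;
  const tmp 6 ;; load ratNum tmp ;; const tmp 7 ;; load ratDen tmp ;;
  const need 0 ;; loop 1 (add need need supNum) ;;
  const supK 0 ;; const ratK 0 ;; const prefK 0 ;; const out 0

/-- Checks whether the current cell of the last row is a witness. -/
def checkCell : Code Var :=
  load val cur ;;
  ifNZ val
    (add tmp supK supL ;; sub tmp need tmp ;;
      ifNZ tmp (move tmp tmp)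
        (add tmp ratK ratL ;; sub tmp tmp prefK ;; ifNZ tmp (move tmp tmp) (const out 1)))
    (move tmp tmp) ;;
  add cur cur one ;; add supL supL supDen ;; add ratL ratL ratNum

def checkRow : Code Var :=
  const supL 0 ;; const ratL 0 ;; loop 3 checkCell ;;
  add supK supK supDen ;; add ratK ratK ratNum ;; add prefK prefK ratDen

/-- The decision program; `wb` computes the price of the current voter and party. -/
def decide (str wb : Code Var) : Code Var :=
  setup str ;; loop 1 (voterStep wb) ;; targets ;; loop 3 checkRow

/-- The data of an instance, as seen by the program: the input and its length, the numbers of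
voters and parties, and the number of price entries of a voter. -/
structure Input where
  inp : ℕ → ℕ
  len : ℕ
  n : ℕ
  m : ℕ
  stride : ℕ
  eq_zero : ∀ a, len ≤ a → inp a = 0

/-- The registers that are fixed by `setup`, and the unchanged input in the memory. -/
structure Env (D : Input) (s : Store Var) : Prop where
  one : s.reg one = 1
  eight : s.reg eight = 8
  parties : s.reg parties = D.m
  width : s.reg width = D.n + 1
  pref : s.reg pref = D.inp 2
  cap : s.reg cap = D.inp 3 + 1
  size : s.reg size = (D.n + 1) * (D.n + 1)
  stride : s.reg Var.stride = D.stride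
  mem : ∀ a < D.len, s.mem a = D.inp a

def envVars : List Var := [one, eight, parties, width, pref, cap, size, stride]

theorem Env.of_eq {D : Input} {s s' : Store Var} (h : Env D s)
    (hr : ∀ v ∈ envVars, s'.reg v = s.reg v) (hm : ∀ a < D.len, s'.mem a = s.mem a) :
    Env D s' where
  one := (hr _ (by simp [envVars])).trans h.one
  eight := (hr _ (by simp [envVars])).trans h.eight
  parties := (hr _ (by simp [envVars])).trans h.parties
  width := (hr _ (by simp [envVars])).trans h.width
  pref := (hr _ (by simp [envVars])).trans h.pref
  cap := (hr _ (by simp [envVars])).trans h.cap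
  size := (hr _ (by simp [envVars])).trans h.size
  stride := (hr _ (by simp [envVars])).trans h.stride
  mem := fun a ha => (hm a ha).trans (h.mem a ha)

theorem Env.eval {D : Input} {s : Store Var} (h : Env D s) (P : ℕ → ℕ) {p : Code Var}
    (hw : ∀ v ∈ envVars, v ∉ p.writes) (hp : p.storeFree = true) : Env D (p.eval P s) :=
  h.of_eq (fun v hv => eval_reg_of_notMem P (hw v hv))
    fun a _ => by rw [eval_mem_of_storeFree P hp]

/-- The index shift of a party. -/
def Input.off (D : Input) (c : ℕ) : ℕ := if c = D.inp 2 then D.n + 1 else D.inp (8 + c)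

/-- The registers that the price program may change. -/
def scratch : List Var := [cost, tmp, val, ptr, rank]

/-- `wb` adds the price `w i c` of putting the party `c` on top of the `i`-th order to `cost`. -/
structure Prices (P : ℕ → ℕ) (D : Input) (wb : Code Var) (w : ℕ → ℕ → ℕ) : Prop where
  writes : ∀ v ∈ wb.writes, v ∈ scratch
  storeFree : wb.storeFree = true
  cost : ∀ s i c, i < D.n → c < D.m → Env D s → s.reg rankRow = 8 + D.m + i * D.m →
    s.reg priceRow = 8 + D.m + D.n * D.m + i * D.stride → s.reg party = c →
    s.reg bit = D.inp (8 + c) → s.reg Var.cost = 0 → (wb.eval P s).reg Var.cost = w i c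

variable {P : ℕ → ℕ} {D : Input}

theorem eval_prepare {s : Store Var} {c : ℕ} (h : Env D s) (hc : s.reg party = c)
    (hlen : 8 + c < D.len) :
    (prepare.eval P s).reg bit = D.inp (8 + c) ∧ (prepare.eval P s).reg off = D.off c ∧
      (prepare.eval P s).reg cost = 0 := by
  by_cases hp : c = D.inp 2
  · simp [prepare, eval, h.eight, hc, h.pref, Input.off, hp, h.width]
    rw [← hp, h.mem _ hlen]
  · have hz : ¬ (c - D.inp 2 = 0 ∧ D.inp 2 - c = 0) := by omega
    simp [prepare, eval, h.eight, hc, h.pref, h.mem _ hlen, hz, Input.off, hp]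

theorem eval_push {s : Store Var} (h1 : s.reg one = 1) :
    (push.eval P s).reg src = s.reg src + 1 ∧
    (push.eval P s).mem = Function.update s.mem (s.reg src + s.reg size + s.reg off)
      (max (s.mem (s.reg src + s.reg size + s.reg off)) (s.mem (s.reg src) - s.reg cost)) := by
  simp [push, eval, h1]
  congr 1
  omega

theorem eval_pushRow {s : Store Var} {N : ℕ} (hP : P 3 = N) (h1 : s.reg one = 1)
    (hS : s.reg size = N * N) :
    (∀ a < s.reg cur + N * N, (pushRow.eval P s).mem a = s.mem a) ∧
    ∀ j, (pushRow.eval P s).mem (s.reg cur + N * N + j) =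
      max (s.mem (s.reg cur + N * N + j))
        (if s.reg off ≤ j ∧ j - s.reg off < N * N then
          s.mem (s.reg cur + (j - s.reg off)) - s.reg cost else 0) := by
  have e : pushRow.eval P s = (push.eval P)^[N * N] ((move src cur).eval P s) := by
    rw [Function.iterate_mul]
    simp [pushRow, eval, hP]
  rw [e]
  have key : ∀ t ≤ N * N, ∀ s', s' = (push.eval P)^[t] ((move src cur).eval P s) →
      (∀ v ∈ [one, cur, size, off, cost], s'.reg v = s.reg v) ∧
      s'.reg src = s.reg cur + t ∧
      (∀ a < s.reg cur + N * N, s'.mem a = s.mem a) ∧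
      ∀ j, s'.mem (s.reg cur + N * N + j) =
        max (s.mem (s.reg cur + N * N + j))
          (if s.reg off ≤ j ∧ j - s.reg off < t then
            s.mem (s.reg cur + (j - s.reg off)) - s.reg cost else 0) := by
    intro t
    induction t with
    | zero =>
      rintro _ s' rfl
      simp [eval]
    | succ t ih =>
      rintro ht s' rfl
      rw [Function.iterate_succ_apply']
      obtain ⟨hv, hsrc, hlo, hhi⟩ := ih (by omega) _ rfl
      set s₁ := (push.eval P)^[t] ((move src cur).eval P s)
      have g1 : s₁.reg one = 1 := (hv _ (by simp)).trans h1
      have g2 : s₁.reg size = N * N := (hv _ (by simp)).trans hS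
      have g3 : s₁.reg off = s.reg off := hv _ (by simp)
      have g4 : s₁.reg cost = s.reg cost := hv _ (by simp)
      obtain ⟨p1, p2⟩ := eval_push (P := P) g1
      refine ⟨fun v hv' => ?_, ?_, fun a ha => ?_, fun j => ?_⟩
      · rw [eval_reg_of_notMem P, hv v hv']
        revert v; decide
      · rw [p1, hsrc]; omega
      · rw [p2, Function.update_of_ne, hlo a ha]
        omega
      · have ea : s₁.reg src + s₁.reg size + s₁.reg off = s.reg cur + N * N + (t + s.reg off) := by
          omega
        rw [p2, ea, hsrc, hlo (s.reg cur + t) (by omega), g4]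
        by_cases hj : j = t + s.reg off
        · subst hj
          rw [Function.update_self, hhi]
          simp
        · rw [Function.update_of_ne (by omega), hhi]
          have : (s.reg off ≤ j ∧ j - s.reg off < t + 1) ↔ (s.reg off ≤ j ∧ j - s.reg off < t) := by
            omega
          simp only [this]
  obtain ⟨-, -, h3, h4⟩ := key _ le_rfl _ rfl
  exact ⟨h3, h4⟩

/-- The state in which the row `T` of the table belongs to the first `i` voters, and the next row
accounts for the first `c` parties on top of the `i`-th order. -/
structure RowInv (D : Input) (w : ℕ → ℕ → ℕ) (T : ℕ → ℕ) (i c : ℕ) (s : Store Var) : Prop where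
  env : Env D s
  rankRow : s.reg rankRow = 8 + D.m + i * D.m
  priceRow : s.reg priceRow = 8 + D.m + D.n * D.m + i * D.stride
  cur : s.reg cur = D.len + i * ((D.n + 1) * (D.n + 1))
  party : s.reg party = c
  row : ∀ j < (D.n + 1) * (D.n + 1), s.mem (s.reg Var.cur + j) = T j
  next : ∀ j, s.mem (s.reg Var.cur + (D.n + 1) * (D.n + 1) + j) = dpStage T (w i) D.off c j

theorem rowInv_partyStep {wb : Code Var} {w : ℕ → ℕ → ℕ} (hw : Prices P D wb w)
    (hP : P 3 = D.n + 1) {T : ℕ → ℕ} {i c : ℕ} {s : Store Var} (h : RowInv D w T i c s)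
    (hi : i < D.n) (hc : c < D.m) (hlen : 8 + D.m ≤ D.len)
    (hT : ∀ j, (D.n + 1) * (D.n + 1) ≤ j → T j = 0) :
    RowInv D w T i (c + 1) ((partyStep wb).eval P s) := by
  have hwb : ∀ v, v ∉ scratch → v ∉ wb.writes := fun v hv hv' => hv (hw.writes v hv')
  obtain ⟨b1, b2, b3⟩ := eval_prepare (P := P) h.env h.party (by omega)
  set s₁ := prepare.eval P s with hs₁
  have f1 : ∀ v, v ∉ prepare.writes → s₁.reg v = s.reg v := fun v hv => eval_reg_of_notMem P hv
  have m1 : s₁.mem = s.mem := eval_mem_of_storeFree P (by decide)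
  have e1 : Env D s₁ := h.env.eval P (by decide) (by decide)
  have hcost := hw.cost s₁ i c hi hc e1 ((f1 _ (by decide)).trans h.rankRow)
    ((f1 _ (by decide)).trans h.priceRow) ((f1 _ (by decide)).trans h.party) b1 b3
  set s₂ := wb.eval P s₁ with hs₂
  have f2 : ∀ v, v ∉ scratch → s₂.reg v = s₁.reg v := fun v hv =>
    eval_reg_of_notMem P (hwb v hv)
  have m2 : s₂.mem = s.mem := (eval_mem_of_storeFree P hw.storeFree).trans m1
  have e2 : Env D s₂ := e1.eval P (fun v hv => hwb v (by revert v; decide)) hw.storeFree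
  have hcur : s₂.reg cur = s.reg cur := by rw [f2 _ (by decide), f1 _ (by decide)]
  have hoff : s₂.reg off = D.off c := by rw [f2 _ (by decide), b2]
  obtain ⟨lo, hi'⟩ := eval_pushRow (P := P) hP e2.one e2.size
  set s₃ := pushRow.eval P s₂ with hs₃
  have f3 : ∀ v, v ∉ pushRow.writes → s₃.reg v = s₂.reg v := fun v hv => eval_reg_of_notMem P hv
  have e3 : Env D s₃ := e2.of_eq (fun v hv => f3 v (by revert v; decide)) fun a ha =>
    lo a (by rw [hcur, h.cur]; omega)
  have f4 : ∀ v, v ∉ [party] → ((add party party one).eval P s₃).reg v = s₃.reg v :=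
    fun v hv => eval_reg_of_notMem P hv
  have f : ∀ v ∈ [rankRow, priceRow, cur],
      ((partyStep wb).eval P s).reg v = s.reg v := by
    intro v hv
    change ((add party party one).eval P s₃).reg v = _
    rw [f4, f3, f2, f1] <;> revert v <;> decide
  refine ⟨?_, ?_, ?_, ?_, ?_, ?_, ?_⟩
  · exact e3.eval P (p := add party party one) (by decide) (by decide)
  · rw [f _ (by simp), h.rankRow]
  · rw [f _ (by simp), h.priceRow]
  · rw [f _ (by simp), h.cur]
  · change ((add party party one).eval P s₃).reg party = _
    simp only [Code.eval, Function.update_self]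
    rw [e3.one, f3 _ (by decide), f2 _ (by decide), f1 _ (by decide), h.party]
  · intro j hj
    rw [f _ (by simp)]
    change s₃.mem _ = _
    rw [lo _ (by rw [hcur]; omega), m2, h.row j hj]
  · intro j
    rw [f _ (by simp)]
    change s₃.mem _ = _
    rw [← hcur, hi', hcur, m2, h.next, dpStage, hoff, hcost]
    congr 1
    by_cases h1 : D.off c ≤ j
    · by_cases h2 : j - D.off c < (D.n + 1) * (D.n + 1)
      · rw [if_pos ⟨h1, h2⟩, if_pos h1, h.row _ h2]
      · rw [if_neg (by tauto), if_pos h1, hT _ (by omega), Nat.zero_sub]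
    · rw [if_neg (by tauto), if_neg h1]

/-- The state after the treatment of `i` voters. -/
structure VoterInv (D : Input) (w : ℕ → ℕ → ℕ) (i : ℕ) (s : Store Var) : Prop where
  env : Env D s
  rankRow : s.reg rankRow = 8 + D.m + i * D.m
  priceRow : s.reg priceRow = 8 + D.m + D.n * D.m + i * D.stride
  cur : s.reg cur = D.len + i * ((D.n + 1) * (D.n + 1))
  row : ∀ j, s.mem (s.reg Var.cur + j) = dpTable (D.inp 3) D.m w D.off i j

theorem voterInv_voterStep {wb : Code Var} {w : ℕ → ℕ → ℕ} (hw : Prices P D wb w)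
    (hP2 : P 2 = D.m) (hP : P 3 = D.n + 1) {i : ℕ} {s : Store Var} (h : VoterInv D w i s)
    (hi : i < D.n) (hlen : 8 + D.m ≤ D.len) (hoff : ∀ c < D.m, D.off c ≤ D.n + 1) :
    VoterInv D w (i + 1) ((voterStep wb).eval P s) := by
  have hT : ∀ j, (D.n + 1) * (D.n + 1) ≤ j → dpTable (D.inp 3) D.m w D.off i j = 0 := by
    intro j hj
    refine dpTable_eq_zero hoff (lt_of_lt_of_le ?_ hj)
    gcongr
    omega
  have h0 : RowInv D w (dpTable (D.inp 3) D.m w D.off i) i 0 ((const party 0).eval P s) := by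
    refine ⟨h.env.eval P (by decide) (by decide), ?_, ?_, ?_, ?_, fun j _ => ?_, fun j => ?_⟩
    · simpa [eval] using h.rankRow
    · simpa [eval] using h.priceRow
    · simpa [eval] using h.cur
    · simp [eval]
    · simpa [eval] using h.row j
    · have := h.row ((D.n + 1) * (D.n + 1) + j)
      rw [← add_assoc, hT _ (by omega)] at this
      simpa [eval, dpStage] using this
  have h1 := eval_loop_induction (P := P) (i := 2) (p := partyStep wb)
    (fun c s => RowInv D w (dpTable (D.inp 3) D.m w D.off i) i c s) h0
    fun c s hc hs => rowInv_partyStep hw hP hs hi (by omega) hlen hT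
  rw [hP2] at h1
  set s₁ := (loop 2 (partyStep wb)).eval P ((const party 0).eval P s) with hs₁
  have e : (voterStep wb).eval P s = (add rankRow rankRow parties ;;
    add priceRow priceRow stride ;; add cur cur size).eval P s₁ := rfl
  rw [e]
  refine ⟨h1.env.eval P (by decide) (by decide), ?_, ?_, ?_, fun j => ?_⟩
  · simp [eval, h1.rankRow, h1.env.parties]; ring
  · simp [eval, h1.priceRow, h1.env.stride]; ring
  · simp [eval, h1.cur, h1.env.size]; ring
  · rw [dpTable, ← h1.next j]
    simp [eval, h1.env.size]

theorem voterInv_loop {wb : Code Var} {w : ℕ → ℕ → ℕ} (hw : Prices P D wb w)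
    (hP1 : P 1 = D.n) (hP2 : P 2 = D.m) (hP : P 3 = D.n + 1) {s : Store Var}
    (h : VoterInv D w 0 s) (hlen : 8 + D.m ≤ D.len) (hoff : ∀ c < D.m, D.off c ≤ D.n + 1) :
    VoterInv D w D.n ((loop 1 (voterStep wb)).eval P s) := by
  have := eval_loop_induction (P := P) (i := 1) (p := voterStep wb)
    (fun i s => VoterInv D w i s) h
    fun i s hi hs => voterInv_voterStep hw hP2 hP hs (by omega) hlen hoff
  rwa [hP1] at this

theorem eval_loop_add {d a : Var} (hda : a ≠ d) (i : ℕ) (s : Store Var) :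
    ((loop i (add d d a)).eval P s).reg d = s.reg d + P i * s.reg a := by
  refine (eval_loop_induction (P := P) (fun t s' => s'.reg a = s.reg a ∧
    s'.reg d = s.reg d + t * s.reg a) ⟨rfl, by simp⟩ fun t s' _ hs' => ?_).2
  simp [eval, hda, hs'.1, hs'.2]
  ring

/-- A cell of the last row that witnesses a successful bribe. -/
def Input.Good (D : Input) (T : ℕ → ℕ) (j : ℕ) : Prop :=
  T j ≠ 0 ∧ D.inp 4 * D.n ≤ D.inp 5 * (j / (D.n + 1) + j % (D.n + 1)) ∧
    D.inp 6 * (j / (D.n + 1) + j % (D.n + 1)) ≤ D.inp 7 * (j / (D.n + 1))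

/-- The state before the check of the cell `k * (n + 1) + l` of the last row. -/
structure CheckInv (D : Input) (T : ℕ → ℕ) (k l : ℕ) (s : Store Var) : Prop where
  one : s.reg one = 1
  supDen : s.reg supDen = D.inp 5
  ratNum : s.reg ratNum = D.inp 6
  ratDen : s.reg ratDen = D.inp 7
  need : s.reg need = D.inp 4 * D.n
  supK : s.reg supK = D.inp 5 * k
  ratK : s.reg ratK = D.inp 6 * k
  prefK : s.reg prefK = D.inp 7 * k
  supL : s.reg supL = D.inp 5 * l
  ratL : s.reg ratL = D.inp 6 * l
  cell : ∀ j, k * (D.n + 1) + l ≤ j → s.mem (s.reg cur + (j - (k * (D.n + 1) + l))) = T j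
  out_le : s.reg out ≤ 1
  out_iff : s.reg out = 1 ↔ ∃ j < k * (D.n + 1) + l, D.Good T j

theorem checkInv_checkCell {T : ℕ → ℕ} {k l : ℕ} {s : Store Var} (h : CheckInv D T k l s)
    (hl : l < D.n + 1) : CheckInv D T k (l + 1) (checkCell.eval P s) := by
  have hdiv : (k * (D.n + 1) + l) / (D.n + 1) = k := by
    rw [mul_comm, Nat.mul_add_div (by omega), Nat.div_eq_of_lt hl, add_zero]
  have hmod : (k * (D.n + 1) + l) % (D.n + 1) = l := by
    rw [mul_comm, Nat.mul_add_mod, Nat.mod_eq_of_lt hl]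
  have hgood : D.Good T (k * (D.n + 1) + l) ↔ s.mem (s.reg cur) ≠ 0 ∧
      s.reg need - (s.reg supK + s.reg supL) = 0 ∧
      s.reg ratK + s.reg ratL - s.reg prefK = 0 := by
    have := h.cell _ le_rfl
    rw [Nat.sub_self, add_zero] at this
    rw [Input.Good, hdiv, hmod, this, h.need, h.supK, h.supL, h.ratK, h.ratL, h.prefK,
      Nat.sub_eq_zero_iff_le, Nat.sub_eq_zero_iff_le, mul_add (D.inp 5), mul_add (D.inp 6)]
  have hex : (∃ j < k * (D.n + 1) + (l + 1), D.Good T j) ↔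
      (∃ j < k * (D.n + 1) + l, D.Good T j) ∨ D.Good T (k * (D.n + 1) + l) := by
    constructor
    · rintro ⟨j, hj, hg⟩
      by_cases hj' : j = k * (D.n + 1) + l
      · exact .inr (hj' ▸ hg)
      · exact .inl ⟨j, by omega, hg⟩
    · rintro (⟨j, hj, hg⟩ | hg)
      · exact ⟨j, by omega, hg⟩
      · exact ⟨_, by omega, hg⟩
  have hout : (checkCell.eval P s).reg out =
      if s.mem (s.reg cur) ≠ 0 ∧ s.reg need - (s.reg supK + s.reg supL) = 0 ∧
        s.reg ratK + s.reg ratL - s.reg prefK = 0 then 1 else s.reg out := by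
    by_cases h1 : s.mem (s.reg cur) = 0
    · simp [checkCell, eval, h1]
    by_cases h2 : s.reg need - (s.reg supK + s.reg supL) = 0
    · by_cases h3 : s.reg ratK + s.reg ratL - s.reg prefK = 0
      · simp [checkCell, eval, h1, h2, h3]
      · simp [checkCell, eval, h1, h2, h3]
    · simp [checkCell, eval, h1, h2]
  have hm : (checkCell.eval P s).mem = s.mem := eval_mem_of_storeFree P (by decide)
  have hup : (checkCell.eval P s).reg cur = s.reg cur + 1 ∧
      (checkCell.eval P s).reg supL = D.inp 5 * (l + 1) ∧
      (checkCell.eval P s).reg ratL = D.inp 6 * (l + 1) := by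
    have e : ∃ p : Code Var, (∀ v ∈ [cur, one, supL, ratL, supDen, ratNum], v ∉ p.writes) ∧
        checkCell.eval P s =
        (add cur cur one ;; add supL supL supDen ;; add ratL ratL ratNum).eval P (p.eval P s) :=
      ⟨.seq (load val cur) (ifNZ val
        (add tmp supK supL ;; sub tmp need tmp ;;
          ifNZ tmp (move tmp tmp)
            (add tmp ratK ratL ;; sub tmp tmp prefK ;; ifNZ tmp (move tmp tmp) (const out 1)))
        (move tmp tmp)), by decide, rfl⟩
    obtain ⟨p, hp, e⟩ := e
    have hv : ∀ v ∈ [cur, one, supL, ratL, supDen, ratNum], (p.eval P s).reg v = s.reg v :=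
      fun v hv => eval_reg_of_notMem P (hp v hv)
    set s₁ := p.eval P s
    rw [e]
    simp only [List.mem_cons, List.not_mem_nil, or_false, forall_eq_or_imp, forall_eq] at hv
    obtain ⟨v1, v2, v3, v4, v5, v6⟩ := hv
    simp [eval, v1, v2, v3, v4, v5, v6, h.one, h.supL, h.ratL, h.supDen, h.ratNum, mul_add]
  have f : ∀ v, v ∉ checkCell.writes → (checkCell.eval P s).reg v = s.reg v :=
    fun v hv => eval_reg_of_notMem P hv
  refine ⟨?_, ?_, ?_, ?_, ?_, ?_, ?_, ?_, hup.2.1, hup.2.2, fun j hj => ?_, ?_, ?_⟩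
  · rw [f _ (by decide), h.one]
  · rw [f _ (by decide), h.supDen]
  · rw [f _ (by decide), h.ratNum]
  · rw [f _ (by decide), h.ratDen]
  · rw [f _ (by decide), h.need]
  · rw [f _ (by decide), h.supK]
  · rw [f _ (by decide), h.ratK]
  · rw [f _ (by decide), h.prefK]
  · rw [hm, hup.1, ← h.cell j (by omega)]
    congr 1
    omega
  · rw [hout]
    have := h.out_le
    split_ifs <;> omega
  · rw [hex, hgood, ← h.out_iff, hout]
    split_ifs with hg
    · simp [hg]
    · simp [hg]

theorem checkInv_checkRow (hP : P 3 = D.n + 1) {T : ℕ → ℕ} {k : ℕ} {s : Store Var}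
    (h : CheckInv D T k 0 ((const supL 0 ;; const ratL 0).eval P s)) :
    CheckInv D T (k + 1) 0 ((const supL 0 ;; const ratL 0).eval P (checkRow.eval P s)) := by
  have h1 := eval_loop_induction (P := P) (i := 3) (p := checkCell)
    (fun l s => CheckInv D T k l s) h fun l s hl hs => checkInv_checkCell hs (by omega)
  rw [hP] at h1
  set s₁ := (loop 3 checkCell).eval P ((const supL 0 ;; const ratL 0).eval P s) with hs₁
  have e : checkRow.eval P s = (add supK supK supDen ;;
    add ratK ratK ratNum ;; add prefK prefK ratDen).eval P s₁ := rfl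
  rw [e]
  have ek : (k + 1) * (D.n + 1) + 0 = k * (D.n + 1) + (D.n + 1) := by ring
  refine ⟨?_, ?_, ?_, ?_, ?_, ?_, ?_, ?_, ?_, ?_, fun j hj => ?_, ?_, ?_⟩
  · simpa [eval] using h1.one
  · simpa [eval] using h1.supDen
  · simpa [eval] using h1.ratNum
  · simpa [eval] using h1.ratDen
  · simpa [eval] using h1.need
  · simp [eval, h1.supK, h1.supDen, mul_add]
  · simp [eval, h1.ratK, h1.ratNum, mul_add]
  · simp [eval, h1.prefK, h1.ratDen, mul_add]
  · simp [eval]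
  · simp [eval]
  · rw [ek] at hj ⊢
    simpa [eval] using h1.cell j hj
  · simpa [eval] using h1.out_le
  · rw [ek]
    simpa [eval] using h1.out_iff

theorem eval_check (hP1 : P 1 = D.n) (hP : P 3 = D.n + 1) {T : ℕ → ℕ} {s : Store Var}
    (h : Env D s) (hlen : 8 ≤ D.len) (hrow : ∀ j, s.mem (s.reg cur + j) = T j) :
    ((targets ;; loop 3 checkRow).eval P s).reg out ≤ 1 ∧
    (((targets ;; loop 3 checkRow).eval P s).reg out = 1 ↔
      ∃ j < (D.n + 1) * (D.n + 1), D.Good T j) := by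
  set s₁ := targets.eval P s with hs₁
  have m1 : s₁.mem = s.mem := eval_mem_of_storeFree P (by decide)
  have f1 : ∀ v, v ∉ targets.writes → s₁.reg v = s.reg v := fun v hv => eval_reg_of_notMem P hv
  have hneed : s₁.reg need = D.inp 4 * D.n := by
    set s₂ := (const tmp 4 ;; load supNum tmp ;; const tmp 5 ;; load supDen tmp ;;
      const tmp 6 ;; load ratNum tmp ;; const tmp 7 ;; load ratDen tmp ;;
      const need 0).eval P s with hs₂
    have e : s₁ = (const supK 0 ;; const ratK 0 ;; const prefK 0 ;; const out 0).eval P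
      ((loop 1 (add need need supNum)).eval P s₂) := rfl
    rw [e, eval_reg_of_notMem P (by decide), eval_loop_add (by decide) 1 s₂, hP1]
    simp [hs₂, eval, h.mem 4 (by omega), mul_comm]
  have hval : s₁.reg supDen = D.inp 5 ∧ s₁.reg ratNum = D.inp 6 ∧ s₁.reg ratDen = D.inp 7 := by
    set s₂ := (const tmp 4 ;; load supNum tmp ;; const tmp 5 ;; load supDen tmp ;;
      const tmp 6 ;; load ratNum tmp ;; const tmp 7 ;; load ratDen tmp ;;
      const need 0).eval P s with hs₂
    have e : s₁ = (loop 1 (add need need supNum) ;; const supK 0 ;; const ratK 0 ;;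
      const prefK 0 ;; const out 0).eval P s₂ := rfl
    rw [e]
    refine ⟨(eval_reg_of_notMem P (by decide)).trans ?_,
      (eval_reg_of_notMem P (by decide)).trans ?_, (eval_reg_of_notMem P (by decide)).trans ?_⟩
    · simp [hs₂, eval, h.mem 5 (by omega)]
    · simp [hs₂, eval, h.mem 6 (by omega)]
    · simp [hs₂, eval, h.mem 7 (by omega)]
  have hz : ∀ v ∈ [supK, ratK, prefK, out], s₁.reg v = 0 := by
    intro v hv
    simp only [hs₁, targets, eval]
    revert v
    simp
  have h0 : CheckInv D T 0 0 ((const supL 0 ;; const ratL 0).eval P s₁) := by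
    refine ⟨?_, ?_, ?_, ?_, ?_, ?_, ?_, ?_, ?_, ?_, fun j hj => ?_, ?_, ?_⟩
    · simpa [eval, f1 one (by decide)] using h.one
    · simpa [eval] using hval.1
    · simpa [eval] using hval.2.1
    · simpa [eval] using hval.2.2
    · simpa [eval] using hneed
    · simpa [eval] using hz supK (by simp)
    · simpa [eval] using hz ratK (by simp)
    · simpa [eval] using hz prefK (by simp)
    · simp [eval]
    · simp [eval]
    · simpa [eval, m1, f1 cur (by decide)] using hrow j
    · simp [eval, hz out]
    · simp [eval, hz out]
  have h1 := eval_loop_induction (P := P) (i := 3) (p := checkRow)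
    (fun k s => CheckInv D T k 0 ((const supL 0 ;; const ratL 0).eval P s)) h0
    fun k s _ hs => checkInv_checkRow hP hs
  rw [hP] at h1
  refine ⟨?_, ?_⟩
  · simpa [eval] using h1.out_le
  · simpa [eval] using h1.out_iff

/-- `str` computes the number of price entries of a voter. -/
structure Strides (P : ℕ → ℕ) (D : Input) (str : Code Var) : Prop where
  writes : ∀ v ∈ str.writes, v ∈ [stride, tmp]
  storeFree : str.storeFree = true
  stride : ∀ s : Store Var, s.reg one = 1 → s.reg parties = D.m →
    (str.eval P s).reg Var.stride = D.stride

theorem voterInv_setup {str : Code Var} (hstr : Strides P D str) (w : ℕ → ℕ → ℕ)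
    (hP1 : P 1 = D.n) (hP2 : P 2 = D.m) (hP : P 3 = D.n + 1)
    {s : Store Var} (hout : s.reg out = D.len) (hsize : s.reg size = 0) (hmem : s.mem = D.inp) :
    VoterInv D w 0 ((setup str).eval P s) := by
  set s₁ := (const one 1 ;; param parties 2 ;; param width 3 ;; const eight 8 ;;
    const tmp 2 ;; load pref tmp ;; const tmp 3 ;; load cap tmp ;; add cap cap one).eval P s
    with hs₁
  have m1 : s₁.mem = D.inp := (eval_mem_of_storeFree P (by decide)).trans hmem
  have v1 : s₁.reg one = 1 ∧ s₁.reg eight = 8 ∧ s₁.reg parties = D.m ∧ s₁.reg width = D.n + 1 ∧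
      s₁.reg pref = D.inp 2 ∧ s₁.reg cap = D.inp 3 + 1 ∧ s₁.reg size = 0 ∧
      s₁.reg out = D.len := by
    simp [hs₁, eval, hP2, hP, hmem, hsize, hout]
  obtain ⟨o1, e1, p1, w1, f1, c1, z1, l1⟩ := v1
  set s₂ := (loop 3 (add size size width)).eval P s₁ with hs₂
  have r2 : ∀ v, v ∉ [size] → s₂.reg v = s₁.reg v := fun v hv => eval_reg_of_notMem P hv
  have m2 : s₂.mem = D.inp := (eval_mem_of_storeFree P (by decide)).trans m1
  have z2 : s₂.reg size = (D.n + 1) * (D.n + 1) := by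
    rw [hs₂, eval_loop_add (by decide), z1, w1, hP, zero_add]
  set s₃ := (add rankRow eight parties ;; move priceRow rankRow).eval P s₂ with hs₃
  have r3 : ∀ v, v ∉ [rankRow, priceRow] → s₃.reg v = s₂.reg v :=
    fun v hv => eval_reg_of_notMem P hv
  have m3 : s₃.mem = D.inp := m2
  have k3 : s₃.reg rankRow = 8 + D.m ∧ s₃.reg priceRow = 8 + D.m := by
    simp [hs₃, eval, r2 eight (by decide), r2 parties (by decide), e1, p1]
  set s₄ := (loop 1 (add priceRow priceRow parties)).eval P s₃ with hs₄
  have r4 : ∀ v, v ∉ [priceRow] → s₄.reg v = s₃.reg v := fun v hv => eval_reg_of_notMem P hv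
  have m4 : s₄.mem = D.inp := (eval_mem_of_storeFree P (by decide)).trans m3
  have k4 : s₄.reg priceRow = 8 + D.m + D.n * D.m := by
    rw [hs₄, eval_loop_add (by decide), k3.2, hP1, r3 _ (by decide), r2 _ (by decide), p1]
  have r : ∀ v, v ∉ [rankRow, priceRow, size] → s₄.reg v = s₁.reg v := by
    intro v hv
    simp only [List.mem_cons, List.not_mem_nil, or_false, not_or] at hv
    rw [r4 v (by simp [hv]), r3 v (by simp [hv]), r2 v (by simp [hv])]
  set s₅ := str.eval P s₄ with hs₅
  have r5 : ∀ v, v ∉ [stride, tmp] → s₅.reg v = s₄.reg v := fun v hv =>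
    eval_reg_of_notMem P fun hv' => hv (hstr.writes v hv')
  have m5 : s₅.mem = D.inp := (eval_mem_of_storeFree P hstr.storeFree).trans m4
  have t5 : s₅.reg stride = D.stride :=
    hstr.stride _ ((r _ (by decide)).trans o1) ((r _ (by decide)).trans p1)
  set s₆ := (move cur out ;; store cur cap).eval P s₅ with hs₆
  have r6 : ∀ v, v ∉ [cur] → s₆.reg v = s₅.reg v := fun v hv => eval_reg_of_notMem P hv
  have l6 : s₆.reg cur = D.len := by
    simp [hs₆, eval, r5 out (by decide), r out (by decide), l1]
  have m6 : s₆.mem = Function.update D.inp D.len (D.inp 3 + 1) := by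
    simp [hs₆, eval, r5 out (by decide), r out (by decide), l1, m5, r5 cap (by decide),
      r cap (by decide), c1]
  have q : ∀ v, v ∉ [rankRow, priceRow, size, stride, tmp, cur] → s₆.reg v = s₁.reg v := by
    intro v hv
    simp only [List.mem_cons, List.not_mem_nil, or_false, not_or] at hv
    rw [r6 v (by simp [hv]), r5 v (by simp [hv]), r v (by simp [hv])]
  have e : (setup str).eval P s = s₆ := rfl
  rw [e]
  refine ⟨⟨?_, ?_, ?_, ?_, ?_, ?_, ?_, ?_, fun a ha => ?_⟩, ?_, ?_, ?_, fun j => ?_⟩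
  · rw [q _ (by decide), o1]
  · rw [q _ (by decide), e1]
  · rw [q _ (by decide), p1]
  · rw [q _ (by decide), w1]
  · rw [q _ (by decide), f1]
  · rw [q _ (by decide), c1]
  · rw [r6 _ (by decide), r5 _ (by decide), r4 _ (by decide), r3 _ (by decide), z2]
  · rw [r6 _ (by decide), t5]
  · rw [m6, Function.update_of_ne (by omega)]
  · rw [r6 _ (by decide), r5 _ (by decide), r4 _ (by decide), k3.1, zero_mul, add_zero]
  · rw [r6 _ (by decide), r5 _ (by decide), k4, zero_mul, add_zero]
  · rw [l6, zero_mul, add_zero]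
  · rw [m6, l6, dpTable, Function.update_apply]
    by_cases hj : j = 0
    · simp [hj]
    · rw [if_neg (by omega), if_neg hj, D.eq_zero _ (by omega)]

theorem eval_decide {str wb : Code Var} {w : ℕ → ℕ → ℕ} (hstr : Strides P D str)
    (hw : Prices P D wb w) (hP1 : P 1 = D.n) (hP2 : P 2 = D.m) (hP : P 3 = D.n + 1)
    (hlen : 8 + D.m ≤ D.len) (hoff : ∀ c < D.m, D.off c ≤ D.n + 1)
    {s : Store Var} (hout : s.reg out = D.len) (hsize : s.reg size = 0) (hmem : s.mem = D.inp) :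
    ((Program.decide str wb).eval P s).reg out ≤ 1 ∧
    (((Program.decide str wb).eval P s).reg out = 1 ↔
      ∃ j < (D.n + 1) * (D.n + 1), D.Good (dpTable (D.inp 3) D.m w D.off D.n) j) :=
  have h := voterInv_loop hw hP1 hP2 hP
    (voterInv_setup hstr w hP1 hP2 hP hout hsize hmem) hlen hoff
  eval_check hP1 hP h.env (by omega) h.row

/-! ### The prices -/

theorem mul_add_lt_mul {i n x k : ℕ} (hi : i < n) (hx : x < k) : i * k + x < n * k := by
  have : (i + 1) * k ≤ n * k := Nat.mul_le_mul_right _ hi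
  rw [add_mul] at this
  omega

def swapStride : Code Var := const stride 0 ;; loop 2 (add stride stride parties)

theorem strides_swapStride (hP2 : P 2 = D.m) (hD : D.stride = D.m * D.m) :
    Strides P D swapStride where
  writes := by decide
  storeFree := by decide
  stride := by
    intro s _ hm
    rw [swapStride, eval, eval_loop_add (by decide), hP2, hD]
    simp [eval, hm]

def shiftStride : Code Var :=
  const stride 1 ;; const tmp 0 ;; loop 2 (add stride stride tmp ;; add tmp tmp one)

theorem strides_shiftStride (hP2 : P 2 = D.m) (hD : D.stride = D.m.choose 2 + 1) :
    Strides P D shiftStride where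
  writes := by decide
  storeFree := by decide
  stride := by
    intro s h1 _
    have := eval_loop_induction (P := P) (i := 2) (p := add stride stride tmp ;; add tmp tmp one)
      (s := (const stride 1 ;; const tmp 0).eval P s)
      (fun t s' => s'.reg one = 1 ∧ s'.reg tmp = t ∧ s'.reg stride = t.choose 2 + 1)
      (by simp [eval, h1]) (by
        rintro t s' - ⟨g1, g2, g3⟩
        simp [eval, g1, g2, g3, Nat.choose_succ_succ' t 1]
        omega)
    rw [hD, ← hP2]
    exact this.2.2

def swapCell : Code Var :=
  load val tmp ;; sub val rank val ;;
  ifNZ val (load val ptr ;; add cost cost val) (move val val) ;;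
  add tmp tmp one ;; add ptr ptr parties

/-- The prices of the swaps that bring the current party to the top. -/
def swapCost : Code Var :=
  add tmp rankRow party ;; load rank tmp ;; add ptr priceRow party ;; move tmp rankRow ;;
  loop 2 swapCell

/-- The rank of the party `c` for the voter `i`. -/
def Input.rank (D : Input) (i c : ℕ) : ℕ := D.inp (8 + D.m + i * D.m + c)

/-- The entry `k` of the prices of the voter `i`. -/
def Input.price (D : Input) (i k : ℕ) : ℕ := D.inp (8 + D.m + D.n * D.m + i * D.stride + k)

def Input.swapCost (D : Input) (i c : ℕ) : ℕ :=
  ∑ x ∈ Finset.range D.m, if D.rank i x < D.rank i c then D.price i (x * D.m + c) else 0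

theorem prices_swapCost (hP2 : P 2 = D.m) (hD : D.stride = D.m * D.m)
    (hlen : 8 + D.m + D.n * D.m + D.n * D.stride ≤ D.len) :
    Prices P D swapCost D.swapCost where
  writes := by decide
  storeFree := by decide
  cost := by
    intro s i c hi hc h hr hp hpa _ h0
    set s₁ := (add tmp rankRow party ;; load rank tmp ;; add ptr priceRow party ;;
      move tmp rankRow).eval P s with hs₁
    have hrk : ∀ x < D.m, s.mem (8 + D.m + i * D.m + x) = D.rank i x := fun x hx =>
      h.mem _ (by have := mul_add_lt_mul hi hx; omega)
    have hpr : ∀ x < D.m, s.mem (8 + D.m + D.n * D.m + i * D.stride + (x * D.m + c)) =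
        D.price i (x * D.m + c) := fun x hx =>
      h.mem _ (by
        have := mul_add_lt_mul hi (hD ▸ mul_add_lt_mul hx hc : x * D.m + c < D.stride)
        omega)
    have key := eval_loop_induction (P := P) (i := 2) (p := swapCell) (s := s₁)
      (fun t s' => (s'.mem = s.mem ∧ s'.reg one = 1 ∧ s'.reg parties = D.m ∧
        s'.reg rank = D.rank i c) ∧ s'.reg tmp = 8 + D.m + i * D.m + t ∧
        s'.reg ptr = 8 + D.m + D.n * D.m + i * D.stride + (t * D.m + c) ∧
        s'.reg cost = ∑ x ∈ Finset.range t,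
          if D.rank i x < D.rank i c then D.price i (x * D.m + c) else 0)
      (by simp [hs₁, eval, h.one, h.parties, hr, hpa, hrk c hc, hp, h0]) (by
        rintro t s' ht ⟨⟨g1, g2, g3, g4⟩, g5, g6, g7⟩
        have hv : s'.mem (s'.reg tmp) = D.rank i t := by rw [g1, g5, hrk t (by omega)]
        have hq : s'.mem (s'.reg ptr) = D.price i (t * D.m + c) := by
          rw [g1, g6, hpr t (by omega)]
        refine ⟨⟨?_, ?_, ?_, ?_⟩, ?_⟩
        · rw [eval_mem_of_storeFree P (by decide), g1]
        · rw [eval_reg_of_notMem P (by decide), g2]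
        · rw [eval_reg_of_notMem P (by decide), g3]
        · rw [eval_reg_of_notMem P (by decide), g4]
        · rw [Finset.sum_range_succ, ← g7]
          by_cases hlt : D.rank i t < D.rank i c
          · have hz : ¬ D.rank i c - D.rank i t = 0 := by omega
            simp [swapCell, eval, hv, g4, hz, hq, g2, g3, hlt]
            rw [g5, g6]
            constructor <;> ring
          · have hz : D.rank i c - D.rank i t = 0 := by omega
            simp [swapCell, eval, hv, g4, hz, g2, g3, hlt]
            rw [g5, g6]
            constructor <;> ring)
    have := key.2.2.2
    rw [hP2] at this
    exact this

def shiftCell : Code Var :=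
  load val tmp ;; sub val rank val ;;
  ifNZ val (load val ptr ;; ifNZ val (add cost cost cap) (move val val)) (move val val) ;;
  add tmp tmp one ;; add ptr ptr one

/-- The price of shifting the current party to the top, and more than the budget if a party outside
the coalition would pass a member of the coalition. -/
def shiftCost : Code Var :=
  add tmp rankRow party ;; load rank tmp ;; add ptr priceRow rank ;; load cost ptr ;;
  ifNZ bit (move tmp tmp) (move tmp rankRow ;; move ptr eight ;; loop 2 shiftCell)

def Input.shiftCost (D : Input) (i c : ℕ) : ℕ :=
  D.price i (D.rank i c) + if D.inp (8 + c) = 0 then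
    ∑ x ∈ Finset.range D.m,
      if D.rank i x < D.rank i c ∧ D.inp (8 + x) ≠ 0 then D.inp 3 + 1 else 0
    else 0

theorem prices_shiftCost (hP2 : P 2 = D.m)
    (hrank : ∀ i < D.n, ∀ c < D.m, D.rank i c < D.stride)
    (hlen : 8 + D.m + D.n * D.m + D.n * D.stride ≤ D.len) :
    Prices P D shiftCost D.shiftCost where
  writes := by decide
  storeFree := by decide
  cost := by
    intro s i c hi hc h hr hp hpa hb h0
    have hrk : ∀ x < D.m, s.mem (8 + D.m + i * D.m + x) = D.rank i x := fun x hx =>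
      h.mem _ (by have := mul_add_lt_mul hi hx; omega)
    have hpr : s.mem (8 + D.m + D.n * D.m + i * D.stride + D.rank i c) =
        D.price i (D.rank i c) :=
      h.mem _ (by have := mul_add_lt_mul hi (hrank i hi c hc); omega)
    by_cases hbc : D.inp (8 + c) = 0
    · set s₁ := (add tmp rankRow party ;; load rank tmp ;; add ptr priceRow rank ;;
        load cost ptr ;; move tmp rankRow ;; move ptr eight).eval P s with hs₁
      have e : shiftCost.eval P s = (loop 2 shiftCell).eval P s₁ := by
        rw [hs₁]
        simp [shiftCost, eval, hb, hbc]
      have key := eval_loop_induction (P := P) (i := 2) (p := shiftCell) (s := s₁)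
        (fun t s' => (s'.mem = s.mem ∧ s'.reg one = 1 ∧ s'.reg cap = D.inp 3 + 1 ∧
          s'.reg rank = D.rank i c) ∧ s'.reg tmp = 8 + D.m + i * D.m + t ∧
          s'.reg ptr = 8 + t ∧
          s'.reg cost = D.price i (D.rank i c) + ∑ x ∈ Finset.range t,
            if D.rank i x < D.rank i c ∧ D.inp (8 + x) ≠ 0 then D.inp 3 + 1 else 0)
        (by simp [hs₁, eval, h.one, h.cap, h.eight, hr, hpa, hrk c hc, hp, hpr]) (by
          rintro t s' ht ⟨⟨g1, g2, g3, g4⟩, g5, g6, g7⟩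
          have hv : s'.mem (s'.reg tmp) = D.rank i t := by rw [g1, g5, hrk t (by omega)]
          have hq : s'.mem (s'.reg ptr) = D.inp (8 + t) := by
            rw [g1, g6, h.mem _ (by omega)]
          refine ⟨⟨?_, ?_, ?_, ?_⟩, ?_⟩
          · rw [eval_mem_of_storeFree P (by decide), g1]
          · rw [eval_reg_of_notMem P (by decide), g2]
          · rw [eval_reg_of_notMem P (by decide), g3]
          · rw [eval_reg_of_notMem P (by decide), g4]
          · rw [Finset.sum_range_succ, ← add_assoc (D.price i (D.rank i c)), ← g7]
            by_cases hlt : D.rank i t < D.rank i c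
            · have hz : ¬ D.rank i c - D.rank i t = 0 := by omega
              by_cases hbt : D.inp (8 + t) = 0
              · simp [shiftCell, eval, hv, g4, hz, hq, g2, hbt]
                omega
              · simp [shiftCell, eval, hv, g4, hz, hq, g2, g3, hlt, hbt]
                omega
            · have hz : D.rank i c - D.rank i t = 0 := by omega
              simp [shiftCell, eval, hv, g4, hz, g2, hlt]
              omega)
      rw [e, key.2.2.2, hP2, Input.shiftCost, if_pos hbc]
    · simp [shiftCost, eval, hb, hbc, hr, hpa, hrk c hc, hp, hpr, Input.shiftCost]

end Program

/-! ## Plurality elections -/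

theorem score_plurality {n m : ℕ} (𝒪 : Fin n → PrefOrder m) (f : Fin n → Fin m)
    (hf : ∀ i, (𝒪 i (f i) : ℕ) = 0) (S : Finset (Fin m)) :
    score (plurality m) 𝒪 S = (Finset.univ.filter fun i => f i ∈ S).card := by
  have h : ∀ i c, plurality m (𝒪 i) c = if f i = c then 1 else 0 := by
    intro i c
    have : (𝒪 i).pos c = 1 ↔ f i = c := by
      rw [PrefOrder.pos, Nat.add_eq_right, ← hf i, Fin.val_inj, (𝒪 i).injective.eq_iff, eq_comm]
    simp only [plurality, this]
  rw [score, Finset.card_filter]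
  refine Finset.sum_congr rfl fun i _ => ?_
  simp [h]

theorem seatsOf_zero {n m : ℕ} (γ : Scoring m) (𝒪 : Fin n → PrefOrder m) (S : Finset (Fin m)) :
    seatsOf γ 0 𝒪 S = (score γ 𝒪 S : ℚ) / score γ 𝒪 Finset.univ := by
  have hsum : ∀ S : Finset (Fin m), ∑ c ∈ S, (score γ 𝒪 {c} : ℚ) = score γ 𝒪 S := by
    intro S
    rw [← Nat.cast_sum]
    congr 1
    simp only [score, Finset.sum_singleton]
    exact Finset.sum_comm
  have hact : ∀ c, Active γ 0 𝒪 c := fun c => by simp [Active]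
  simp only [seatsOf, seats, hact, if_true, Finset.filter_true, hsum, ← Finset.sum_div]

theorem seats_eq_seatsOf {n m : ℕ} (γ : Scoring m) (t : ℚ) (𝒪 : Fin n → PrefOrder m)
    (c : Fin m) : seats γ t 𝒪 c = seatsOf γ t 𝒪 {c} := by simp [seatsOf]

theorem rat_mul_le_iff {q : ℚ} (hq : 0 ≤ q) (a b : ℕ) :
    q * a ≤ b ↔ q.num.toNat * a ≤ q.den * b := by
  have hd : (0 : ℚ) < q.den := by exact_mod_cast q.pos
  have hn : ((q.num.toNat : ℕ) : ℚ) = q.num := by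
    exact_mod_cast Int.toNat_of_nonneg (Rat.num_nonneg.2 hq)
  have e : q * a ≤ b ↔ (q.num.toNat : ℚ) * a ≤ q.den * b := by
    rw [hn]
    conv_lhs => rw [← Rat.num_div_den q]
    rw [div_mul_eq_mul_div, div_le_iff₀ hd, mul_comm (b : ℚ)]
  rw [e]
  exact_mod_cast Iff.rfl

/-- A successful bribe amounts to a choice of the top parties, provided that `w i c` is the least
price of a permissible order of the voter `i` with the party `c` on top. -/
theorem CBPData.hasBribe_iff (I : CBPData) {perm : Fin I.n → PrefOrder I.m → Prop}
    {π : Fin I.n → PrefOrder I.m → ℕ} {w : Fin I.n → Fin I.m → ℕ}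
    (hle : ∀ i O' c, perm i O' → (O' c : ℕ) = 0 → w i c ≤ π i O')
    (hex : ∀ i c, w i c ≤ I.budget → ∃ O', perm i O' ∧ (O' c : ℕ) = 0 ∧ π i O' = w i c) :
    I.HasBribe (plurality I.m) 0 perm π ↔ ∃ f : Fin I.n → Fin I.m,
      ∑ i, w i (f i) ≤ I.budget ∧
      I.φ.num.toNat * I.n ≤ I.φ.den * (Finset.univ.filter fun i => f i ∈ I.coalition).card ∧
      I.ρ.num.toNat * (Finset.univ.filter fun i => f i ∈ I.coalition).card ≤
        I.ρ.den * (Finset.univ.filter fun i => f i = I.preferred).card := by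
  have hn : (0 : ℚ) < I.n := by exact_mod_cast I.n_pos
  have key : ∀ (𝒪' : Fin I.n → PrefOrder I.m) (f : Fin I.n → Fin I.m),
      (∀ i, (𝒪' i (f i) : ℕ) = 0) →
      ((I.φ * seatsOf (plurality I.m) 0 𝒪' Finset.univ ≤
          seatsOf (plurality I.m) 0 𝒪' I.coalition ↔
        I.φ.num.toNat * I.n ≤ I.φ.den * (Finset.univ.filter fun i => f i ∈ I.coalition).card) ∧
      (I.ρ * seatsOf (plurality I.m) 0 𝒪' I.coalition ≤
          seats (plurality I.m) 0 𝒪' I.preferred ↔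
        I.ρ.num.toNat * (Finset.univ.filter fun i => f i ∈ I.coalition).card ≤
          I.ρ.den * (Finset.univ.filter fun i => f i = I.preferred).card)) := by
    intro 𝒪' f hf
    rw [seats_eq_seatsOf]
    simp only [seatsOf_zero, score_plurality 𝒪' f hf, Finset.mem_univ, Finset.filter_true,
      Finset.card_univ, Fintype.card_fin, Finset.mem_singleton, ← mul_div_assoc,
      div_le_div_iff_of_pos_right hn]
    exact ⟨rat_mul_le_iff I.φ_nonneg _ _, rat_mul_le_iff I.ρ_nonneg _ _⟩
  constructor
  · rintro ⟨𝒪', hp, hb, h1, h2⟩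
    have hm : 0 < I.m := I.preferred.pos
    let f : Fin I.n → Fin I.m := fun i => (𝒪' i).symm ⟨0, hm⟩
    have hf : ∀ i, (𝒪' i (f i) : ℕ) = 0 := fun i => by simp [f]
    exact ⟨f, (Finset.sum_le_sum fun i _ => hle i _ _ (hp i) (hf i)).trans hb,
      (key 𝒪' f hf).1.1 h1, (key 𝒪' f hf).2.1 h2⟩
  · rintro ⟨f, hb, h1, h2⟩
    have hwi : ∀ i, w i (f i) ≤ I.budget := fun i =>
      (Finset.single_le_sum (f := fun i => w i (f i)) (fun _ _ => Nat.zero_le _)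
        (Finset.mem_univ i)).trans hb
    choose 𝒪' hp hf hπ using fun i => hex i (f i) (hwi i)
    exact ⟨𝒪', hp, by simpa [hπ] using hb, (key 𝒪' f hf).1.2 h1, (key 𝒪' f hf).2.2 h2⟩

/-! ### Moving a party to the top -/

namespace PrefOrder

variable {m : ℕ}

/-- The pairs that are swapped when `c` moves to the top. -/
def topPairs (O : PrefOrder m) (c : Fin m) : Finset (Fin m × Fin m) :=
  Finset.univ.filter fun z => O z.1 < O c ∧ z.2 = c

theorem topPairs_subset_swapped (O O' : PrefOrder m) {c : Fin m} (hc : (O' c : ℕ) = 0) :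
    O.topPairs c ⊆ O.swapped O' := by
  rintro ⟨x, y⟩ h
  simp only [topPairs, Finset.mem_filter, Finset.mem_univ, true_and] at h
  obtain ⟨h, rfl⟩ := h
  have hne : (O' x : ℕ) ≠ O' y := fun e => h.ne (by rw [O'.injective (Fin.ext e)])
  have := Fin.lt_def.1 h
  refine Finset.mem_filter.2 ⟨Finset.mem_univ _, ?_, ?_⟩ <;> simp only [Above, pos] <;> omega

theorem card_topPairs (O : PrefOrder m) (c : Fin m) : (O.topPairs c).card = O c := by
  have : O.topPairs c = (Finset.Iio (O c)).image fun r => (O.symm r, c) := by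
    ext ⟨x, y⟩
    rw [topPairs, Finset.mem_filter, Finset.mem_image]
    constructor
    · rintro ⟨-, h, rfl⟩
      exact ⟨O x, Finset.mem_Iio.2 h, by simp⟩
    · rintro ⟨r, hr, e⟩
      obtain ⟨rfl, rfl⟩ := Prod.ext_iff.1 e
      simpa using hr
  rw [this, Finset.card_image_of_injective, Fin.card_Iio]
  exact fun a b h => O.symm.injective (Prod.ext_iff.1 h).1

theorem sum_topPairs (O : PrefOrder m) (c : Fin m) (g : Fin m → Fin m → ℕ) :
    ∑ z ∈ O.topPairs c, g z.1 z.2 = ∑ x, if O x < O c then g x c else 0 := by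
  rw [topPairs, Finset.sum_filter, Fintype.sum_prod_type]
  refine Finset.sum_congr rfl fun x _ => ?_
  by_cases h : O x < O c <;> simp [h]

/-- The order that arises from `O` when `c` moves to the top. -/
def moveTop (O : PrefOrder m) (c : Fin m) : PrefOrder m := O.trans (Fin.cycleRange (O c))

theorem val_moveTop (O : PrefOrder m) (c x : Fin m) :
    (O.moveTop c x : ℕ) =
      if (O x : ℕ) < O c then (O x : ℕ) + 1 else if x = c then 0 else (O x : ℕ) := by
  change ((O c).cycleRange (O x) : ℕ) = _
  split_ifs with h1 h2
  · exact Fin.coe_cycleRange_of_lt h1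
  · subst h2
    have : NeZero m := ⟨(Fin.pos x).ne'⟩
    simp
  · rw [Fin.cycleRange_of_gt]
    refine lt_of_le_of_ne (Fin.le_def.2 (by omega)) fun e => h2 (O.injective e.symm)

theorem val_moveTop_self (O : PrefOrder m) (c : Fin m) : (O.moveTop c c : ℕ) = 0 := by
  simp [val_moveTop]

theorem moveTop_lt_moveTop (O : PrefOrder m) {c x y : Fin m} (hy : y ≠ c) (h : O x < O y) :
    O.moveTop c x < O.moveTop c y := by
  have hne : (O y : ℕ) ≠ O c := fun e => hy (O.injective (Fin.ext e))
  rw [Fin.lt_def] at h ⊢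
  rw [val_moveTop, val_moveTop, if_neg hy]
  by_cases hx : x = c
  · subst hx; simp; split_ifs <;> omega
  · rw [if_neg hx]
    have hne : (O x : ℕ) ≠ O c := fun e => hx (O.injective (Fin.ext e))
    split_ifs <;> omega

theorem swapped_moveTop (O : PrefOrder m) (c : Fin m) :
    O.swapped (O.moveTop c) = O.topPairs c := by
  refine Finset.Subset.antisymm ?_ (topPairs_subset_swapped _ _ (O.val_moveTop_self c))
  rintro ⟨x, y⟩ h
  simp only [swapped, Above, pos, Finset.mem_filter, Finset.mem_univ, true_and,
    add_lt_add_iff_right] at h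
  have hy : y = c := by
    by_contra hy
    have := Fin.lt_def.1 (O.moveTop_lt_moveTop hy (Fin.lt_def.2 h.1))
    omega
  subst hy
  simpa [topPairs] using h.1

end PrefOrder

/-- The least price of bringing `c` to the top by swaps. -/
def SwapInstance.topPrice (I : SwapInstance) (i : Fin I.n) (c : Fin I.m) : ℕ :=
  ∑ x, if I.order i x < I.order i c then I.sw i x c else 0

theorem SwapInstance.pluralityCBP_iff (I : SwapInstance) :
    I.PluralityCBP ↔ ∃ f : Fin I.n → Fin I.m, ∑ i, I.topPrice i (f i) ≤ I.budget ∧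
      I.φ.num.toNat * I.n ≤ I.φ.den * (Finset.univ.filter fun i => f i ∈ I.coalition).card ∧
      I.ρ.num.toNat * (Finset.univ.filter fun i => f i ∈ I.coalition).card ≤
        I.ρ.den * (Finset.univ.filter fun i => f i = I.preferred).card := by
  refine I.hasBribe_iff (fun i O' c _ hc => ?_) fun i c _ => ?_
  · rw [topPrice, price, ← PrefOrder.sum_topPairs]
    exact Finset.sum_le_sum_of_subset ((I.order i).topPairs_subset_swapped O' hc)
  · refine ⟨(I.order i).moveTop c, trivial, PrefOrder.val_moveTop_self _ _, ?_⟩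
    rw [topPrice, price, PrefOrder.swapped_moveTop, PrefOrder.sum_topPairs]

/-- The least price of bringing `c` to the top by permissible shifts, or a number above the budget
if that is impossible. -/
def ShiftInstance.topPrice (I : ShiftInstance) (i : Fin I.n) (c : Fin I.m) : ℕ :=
  I.s i (I.order i c) + if c ∉ I.coalition then
    ∑ x, if I.order i x < I.order i c ∧ x ∈ I.coalition then I.budget + 1 else 0 else 0

theorem ShiftInstance.pluralityCBP_iff (I : ShiftInstance) :
    I.PluralityCBP ↔ ∃ f : Fin I.n → Fin I.m, ∑ i, I.topPrice i (f i) ≤ I.budget ∧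
      I.φ.num.toNat * I.n ≤ I.φ.den * (Finset.univ.filter fun i => f i ∈ I.coalition).card ∧
      I.ρ.num.toNat * (Finset.univ.filter fun i => f i ∈ I.coalition).card ≤
        I.ρ.den * (Finset.univ.filter fun i => f i = I.preferred).card := by
  refine I.hasBribe_iff (fun i O' c hp hc => ?_) fun i c hw => ?_
  · have hz : (if c ∉ I.coalition then ∑ x, if I.order i x < I.order i c ∧ x ∈ I.coalition then
        I.budget + 1 else 0 else 0) = 0 := by
      split_ifs with hcA
      · rfl
      · refine Finset.sum_eq_zero fun x _ => if_neg ?_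
        rintro ⟨hlt, hx⟩
        have := hp x hx c hcA (by simpa [PrefOrder.Above, PrefOrder.pos] using hlt)
        simp [PrefOrder.Above, PrefOrder.pos, hc] at this
    rw [topPrice, hz, add_zero, price, ← PrefOrder.card_topPairs]
    exact I.s_mono i (Finset.card_le_card ((I.order i).topPairs_subset_swapped O' hc))
  · have hno : c ∉ I.coalition → ∀ x ∈ I.coalition, ¬ I.order i x < I.order i c := by
      intro hcA x hx hlt
      have h1 : I.budget + 1 ≤
          ∑ x, if I.order i x < I.order i c ∧ x ∈ I.coalition then I.budget + 1 else 0 := by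
        refine le_trans ?_ (Finset.single_le_sum (fun _ _ => Nat.zero_le _) (Finset.mem_univ x))
        rw [if_pos ⟨hlt, hx⟩]
      rw [topPrice, if_pos hcA] at hw
      omega
    refine ⟨(I.order i).moveTop c, fun x hx y hy h => ?_, PrefOrder.val_moveTop_self _ _, ?_⟩
    · have h' : I.order i x < I.order i y := by
        simpa [PrefOrder.Above, PrefOrder.pos] using h
      have hyc : y ≠ c := by
        rintro rfl
        exact hno hy x hx h'
      simpa [PrefOrder.Above, PrefOrder.pos] using PrefOrder.moveTop_lt_moveTop _ hyc h'
    · rw [topPrice, price, PrefOrder.swapped_moveTop, PrefOrder.card_topPairs]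
      split_ifs with hcA
      · rfl
      · rw [Finset.sum_eq_zero fun x _ => if_neg fun h => hno hcA x h.2 h.1, add_zero]

open Program

/-! ## Reading the encoding -/

theorem length_flatten_ofFn {n k : ℕ} (L : Fin n → List ℕ) (hL : ∀ i, (L i).length = k) :
    (List.ofFn L).flatten.length = n * k := by
  induction n with
  | zero => simp
  | succ n ih =>
    rw [List.ofFn_succ, List.flatten_cons, List.length_append, hL, ih _ fun i => hL _]
    ring

theorem getD_flatten_ofFn {n k : ℕ} (L : Fin n → List ℕ) (hL : ∀ i, (L i).length = k)
    (i : Fin n) {j : ℕ} (hj : j < k) :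
    (List.ofFn L).flatten.getD (i * k + j) 0 = (L i).getD j 0 := by
  induction n with
  | zero => exact i.elim0
  | succ n ih =>
    rw [List.ofFn_succ, List.flatten_cons]
    refine Fin.cases ?_ (fun i => ?_) i
    · rw [List.getD_append _ _ _ _ (by simp [hL, hj])]
      simp
    · have e : ((i.succ : Fin (n + 1)) : ℕ) * k + j - k = i * k + j := by
        rw [Fin.val_succ, add_mul, one_mul]; omega
      rw [List.getD_append_right _ _ _ _ (by rw [hL, Fin.val_succ, add_mul]; omega), hL, e]
      exact ih _ (fun i => hL _) i

theorem getD_ofFn {n : ℕ} (f : Fin n → ℕ) (i : Fin n) : (List.ofFn f).getD i 0 = f i := by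
  simp [List.getD_eq_getElem?_getD]

namespace CBPData

variable (I : CBPData) (t : List ℕ)

theorem length_encode : I.encode.length = 8 + I.m + I.n * I.m := by
  rw [encode, List.length_append, List.length_append, length_flatten_ofFn (k := I.m)]
  · simp
  · simp

theorem getD_encode_coalition (c : Fin I.m) :
    (I.encode ++ t).getD (8 + c) 0 = if c ∈ I.coalition then 1 else 0 := by
  rw [List.getD_append _ _ _ _ (by rw [length_encode]; omega), encode,
    List.getD_append _ _ _ _ (by simp; omega), List.getD_append_right _ _ _ _ (by simp)]
  have : 8 + (c : ℕ) - [I.n, I.m, (I.preferred : ℕ), I.budget, I.φ.num.toNat, I.φ.den,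
    I.ρ.num.toNat, I.ρ.den].length = c := by simp
  rw [this, getD_ofFn]

theorem getD_encode_order (i : Fin I.n) (c : Fin I.m) :
    (I.encode ++ t).getD (8 + I.m + i * I.m + c) 0 = I.order i c := by
  have := mul_add_lt_mul i.2 c.2
  rw [List.getD_append _ _ _ _ (by rw [length_encode]; omega), encode,
    List.getD_append_right _ _ _ _ (by simp; omega)]
  have e : 8 + I.m + i * I.m + (c : ℕ) - ([I.n, I.m, (I.preferred : ℕ), I.budget, I.φ.num.toNat,
      I.φ.den, I.ρ.num.toNat, I.ρ.den] ++
      List.ofFn (fun c : Fin I.m => if c ∈ I.coalition then 1 else 0)).length = i * I.m + c := by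
    simp; omega
  rw [e, getD_flatten_ofFn _ (by simp) i c.2, getD_ofFn]

theorem getD_encode_append (k : ℕ) :
    (I.encode ++ t).getD (8 + I.m + I.n * I.m + k) 0 = t.getD k 0 := by
  rw [List.getD_append_right _ _ _ _ (by rw [length_encode]; omega), length_encode]
  congr 1
  omega

/-- The program input for an instance whose price data are `t`, with `r` entries for each voter. -/
def input (r : ℕ) : Input where
  inp := fun a => (I.encode ++ t).getD a 0
  len := (I.encode ++ t).length
  n := I.n
  m := I.m
  stride := r
  eq_zero := fun _ ha => List.getD_eq_default _ _ ha

variable {t} {r : ℕ}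

theorem off_input (c : Fin I.m) : (I.input t r).off c =
    if c = I.preferred then I.n + 1 else if c ∈ I.coalition then 1 else 0 := by
  have h2 : (I.input t r).inp 2 = I.preferred := rfl
  have h8 : (I.input t r).inp (8 + c) = if c ∈ I.coalition then 1 else 0 :=
    I.getD_encode_coalition t c
  rw [Input.off, h2, h8]
  simp only [Fin.val_inj]
  rfl

theorem sum_off_input (f : Fin I.n → Fin I.m) :
    ∑ i, (I.input t r).off (f i) =
      (Finset.univ.filter fun i => f i = I.preferred).card * (I.n + 1) +
      ((Finset.univ.filter fun i => f i ∈ I.coalition).card -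
        (Finset.univ.filter fun i => f i = I.preferred).card) := by
  have hcard : (Finset.univ.filter fun i => f i ∈ I.coalition).card =
      (Finset.univ.filter fun i => f i = I.preferred).card +
      (Finset.univ.filter fun i => f i ≠ I.preferred ∧ f i ∈ I.coalition).card := by
    rw [← Finset.card_filter_add_card_filter_not (s := Finset.univ.filter fun i => f i ∈ I.coalition)
      (fun i => f i = I.preferred), Finset.filter_filter, Finset.filter_filter]
    congr 2
    · ext i
      simp only [Finset.mem_filter, Finset.mem_univ, true_and, and_iff_right_iff_imp]
      intro h
      rw [h]
      exact I.preferred_mem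
    · ext i
      simp [and_comm]
  rw [hcard, Nat.add_sub_cancel_left, Finset.card_filter, Finset.card_filter, Finset.sum_mul,
    ← Finset.sum_add_distrib]
  refine Finset.sum_congr rfl fun i _ => ?_
  rw [off_input]
  by_cases h : f i = I.preferred <;> simp [h]

/-- The dynamic program decides whether there is a suitable choice of top parties. -/
theorem exists_good_iff {w : Fin I.n → Fin I.m → ℕ} {w' : ℕ → ℕ → ℕ}
    (hw : ∀ (i : Fin I.n) (c : Fin I.m), w' i c = w i c) :
    (∃ j < (I.n + 1) * (I.n + 1), (I.input t r).Good
      (dpTable I.budget I.m w' (I.input t r).off I.n) j) ↔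
    ∃ f : Fin I.n → Fin I.m, ∑ i, w i (f i) ≤ I.budget ∧
      I.φ.num.toNat * I.n ≤ I.φ.den * (Finset.univ.filter fun i => f i ∈ I.coalition).card ∧
      I.ρ.num.toNat * (Finset.univ.filter fun i => f i ∈ I.coalition).card ≤
        I.ρ.den * (Finset.univ.filter fun i => f i = I.preferred).card := by
  have key : ∀ (f : Fin I.n → Fin I.m) (j : ℕ), ∑ i, (I.input t r).off (f i) = j →
      j < (I.n + 1) * (I.n + 1) ∧
      j / (I.n + 1) = (Finset.univ.filter fun i => f i = I.preferred).card ∧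
      j / (I.n + 1) + j % (I.n + 1) = (Finset.univ.filter fun i => f i ∈ I.coalition).card := by
    rintro f j rfl
    have h1 : (Finset.univ.filter fun i => f i = I.preferred).card ≤
        (Finset.univ.filter fun i => f i ∈ I.coalition).card :=
      Finset.card_le_card fun i hi => by
        simp only [Finset.mem_filter, Finset.mem_univ, true_and] at hi ⊢
        rw [hi]
        exact I.preferred_mem
    have h2 : (Finset.univ.filter fun i => f i ∈ I.coalition).card ≤ I.n :=
      (Finset.card_le_univ _).trans_eq (by simp)
    rw [I.sum_off_input f]
    set k := (Finset.univ.filter fun i => f i = I.preferred).card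
    set a := (Finset.univ.filter fun i => f i ∈ I.coalition).card
    have hl : a - k < I.n + 1 := by omega
    have hd : (k * (I.n + 1) + (a - k)) / (I.n + 1) = k := by
      rw [mul_comm, Nat.mul_add_div (by omega), Nat.div_eq_of_lt hl, add_zero]
    have hm : (k * (I.n + 1) + (a - k)) % (I.n + 1) = a - k := by
      rw [mul_comm, Nat.mul_add_mod, Nat.mod_eq_of_lt hl]
    exact ⟨mul_add_lt_mul (by omega) hl, hd, by omega⟩
  have hgood : ∀ T j, (I.input t r).Good T j ↔ T j ≠ 0 ∧
      I.φ.num.toNat * I.n ≤ I.φ.den * (j / (I.n + 1) + j % (I.n + 1)) ∧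
      I.ρ.num.toNat * (j / (I.n + 1) + j % (I.n + 1)) ≤ I.ρ.den * (j / (I.n + 1)) :=
    fun _ _ => Iff.rfl
  constructor
  · rintro ⟨j, -, hg⟩
    obtain ⟨h0, h1, h2⟩ := (hgood _ _).1 hg
    obtain ⟨g, hgm, hgs, hgb⟩ := lt_dpTable_iff.1 (Nat.pos_of_ne_zero h0)
    let f : Fin I.n → Fin I.m := fun i => ⟨g i, hgm i i.2⟩
    have hs : ∑ i, (I.input t r).off (f i) = j := by
      rw [← hgs, Finset.sum_range]
    obtain ⟨-, k1, k2⟩ := key f j hs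
    rw [k2] at h1 h2
    rw [k1] at h2
    refine ⟨f, ?_, h1, h2⟩
    rw [zero_add, Finset.sum_range] at hgb
    refine le_trans (Finset.sum_le_sum fun i _ => ?_) hgb
    rw [← hw]
  · rintro ⟨f, hb, h1, h2⟩
    obtain ⟨hj, k1, k2⟩ := key f _ rfl
    refine ⟨_, hj, (hgood _ _).2 ⟨Nat.pos_iff_ne_zero.1 (lt_dpTable_iff.2 ?_), ?_, ?_⟩⟩
    · have hf : ∀ i : Fin I.n, (if h : (i : ℕ) < I.n then (f ⟨i, h⟩ : ℕ) else 0) = f i :=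
        fun i => dif_pos i.2
      refine ⟨fun x => if h : x < I.n then f ⟨x, h⟩ else 0, fun x hx => ?_, ?_, ?_⟩
      · simp [hx]
      · rw [Finset.sum_range]
        simp only [hf]
      · rw [Finset.sum_range, zero_add]
        simpa only [hf, hw] using hb
    · rwa [k2]
    · rwa [k2, k1]

theorem off_input_le (c : ℕ) (hc : c < I.m) : (I.input t r).off c ≤ I.n + 1 := by
  rw [I.off_input ⟨c, hc⟩]
  split_ifs <;> omega

theorem rank_input (i : Fin I.n) (c : Fin I.m) : (I.input t r).rank i c = I.order i c :=
  I.getD_encode_order t i c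

/-- The program decides the existence of a suitable choice of top parties, given correct
subprograms for the prices. -/
theorem polyTimeDecidable {α : Type} (toData : α → CBPData) (tail : α → List ℕ) (stride : α → ℕ)
    {Q : α → Prop} {w : ∀ x, Fin (toData x).n → Fin (toData x).m → ℕ} {w' : α → ℕ → ℕ → ℕ}
    (hw : ∀ x (i : Fin (toData x).n) (c : Fin (toData x).m), w' x i c = w x i c) {str wb : Code Var}
    (hstr : ∀ x P, P 2 = (toData x).m → Strides P ((toData x).input (tail x) (stride x)) str)
    (hwb : ∀ x P, P 2 = (toData x).m → Prices P ((toData x).input (tail x) (stride x)) wb (w' x))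
    (hQ : ∀ x, Q x ↔ ∃ f : Fin (toData x).n → Fin (toData x).m,
      ∑ i, w x i (f i) ≤ (toData x).budget ∧
      (toData x).φ.num.toNat * (toData x).n ≤
        (toData x).φ.den * (Finset.univ.filter fun i => f i ∈ (toData x).coalition).card ∧
      (toData x).ρ.num.toNat * (Finset.univ.filter fun i => f i ∈ (toData x).coalition).card ≤
        (toData x).ρ.den * (Finset.univ.filter fun i => f i = (toData x).preferred).card) :
    PolyTimeDecidable (fun x => (toData x).encode ++ tail x) Q := by
  have hlen : ∀ x, 8 + (toData x).m + (toData x).n * (toData x).m ≤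
      ((toData x).encode ++ tail x).length := fun x => by
    rw [List.length_append, length_encode]; omega
  have hn : ∀ x, (toData x).n ≤ (toData x).n * (toData x).m := fun x =>
    Nat.le_mul_of_pos_right _ (toData x).preferred.pos
  have main := fun x => eval_decide (P := inputParam ((toData x).encode ++ tail x))
    (s := Store.init Var.out ((toData x).encode ++ tail x))
    (hstr x _ rfl) (hwb x _ rfl) rfl rfl rfl
    (show 8 + (toData x).m ≤ _ from le_trans (by omega) (hlen x)) (toData x).off_input_le
    rfl rfl rfl
  have hiff := fun x => (main x).2.trans (((toData x).exists_good_iff (hw x)).trans (hQ x).symm)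
  refine PolyTimeDecidable.of_code Var.ctorIdx_injective (out := .out) rfl
    (Program.decide str wb) (fun x => ?_) (fun x => ?_) (fun x hx => (hiff x).2 hx)
    fun x hx => ?_
  · change (toData x).n < ((toData x).encode ++ tail x).length
    have := hlen x
    have := hn x
    omega
  · change (toData x).m ≤ ((toData x).encode ++ tail x).length
    have := hlen x
    omega
  · have h1 := (main x).1
    have h2 := mt (hiff x).1 hx
    omega

end CBPData

theorem SwapInstance.polyTimeDecidable :
    PolyTimeDecidable SwapInstance.encode SwapInstance.PluralityCBP := by
  let tail : SwapInstance → List ℕ := fun I => (List.ofFn fun i : Fin I.n =>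
    (List.ofFn fun x : Fin I.m => List.ofFn fun y : Fin I.m => I.sw i x y).flatten).flatten
  have hrow : ∀ (I : SwapInstance) (i : Fin I.n),
      (List.ofFn fun x : Fin I.m => List.ofFn fun y : Fin I.m => I.sw i x y).flatten.length =
        I.m * I.m := fun I i => length_flatten_ofFn _ (by simp)
  refine CBPData.polyTimeDecidable SwapInstance.toCBPData tail (fun I => I.m * I.m)
    (w := SwapInstance.topPrice)
    (w' := fun I => (I.input (tail I) (I.m * I.m)).swapCost) (fun I i c => ?_)
    (fun I P hP => strides_swapStride hP rfl) (fun I P hP => prices_swapCost hP rfl ?_)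
    SwapInstance.pluralityCBP_iff
  · have hp : ∀ x : Fin I.m, (I.input (tail I) (I.m * I.m)).price i (x * I.m + c) =
        I.sw i x c := by
      intro x
      have e : 8 + I.m + I.n * I.m + i * (I.m * I.m) + ((x : ℕ) * I.m + c) =
        8 + I.m + I.n * I.m + (i * (I.m * I.m) + ((x : ℕ) * I.m + c)) := by ring
      change (I.toCBPData.encode ++ tail I).getD
        (8 + I.m + I.n * I.m + i * (I.m * I.m) + (x * I.m + c)) 0 = _
      rw [e, CBPData.getD_encode_append, getD_flatten_ofFn _ (hrow I) i (mul_add_lt_mul x.2 c.2),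
        getD_flatten_ofFn _ (by simp) x c.2, getD_ofFn]
    change ∑ x ∈ Finset.range I.m, _ = _
    rw [Finset.sum_range, SwapInstance.topPrice]
    refine Finset.sum_congr rfl fun x _ => ?_
    simp only [CBPData.rank_input, Fin.val_fin_lt]
    split_ifs
    · exact hp x
    · rfl
  · change 8 + I.m + I.n * I.m + I.n * (I.m * I.m) ≤ (I.toCBPData.encode ++ tail I).length
    rw [List.length_append, CBPData.length_encode, length_flatten_ofFn _ (hrow I)]

theorem lt_choose_two_add_one {k m : ℕ} (h : k < m) : k < m.choose 2 + 1 := by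
  obtain ⟨m, rfl⟩ : ∃ l, m = l + 1 := ⟨m - 1, by omega⟩
  rw [Nat.choose_succ_succ' m 1, Nat.choose_one_right]
  omega

theorem ShiftInstance.polyTimeDecidable :
    PolyTimeDecidable ShiftInstance.encode ShiftInstance.PluralityCBP := by
  let tail : ShiftInstance → List ℕ := fun I =>
    (List.ofFn fun i : Fin I.n => (List.range (I.m.choose 2 + 1)).map (I.s i)).flatten
  have hrow : ∀ (I : ShiftInstance) (i : Fin I.n),
      ((List.range (I.m.choose 2 + 1)).map (I.s i)).length = I.m.choose 2 + 1 := by simp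
  refine CBPData.polyTimeDecidable ShiftInstance.toCBPData tail (fun I => I.m.choose 2 + 1)
    (w := ShiftInstance.topPrice)
    (w' := fun I => (I.input (tail I) (I.m.choose 2 + 1)).shiftCost) (fun I i c => ?_)
    (fun I P hP => strides_shiftStride hP rfl)
    (fun I P hP => prices_shiftCost hP (fun i hi c hc => ?_) ?_)
    ShiftInstance.pluralityCBP_iff
  · have hp : (I.input (tail I) (I.m.choose 2 + 1)).price i (I.order i c) =
        I.s i (I.order i c) := by
      change (I.toCBPData.encode ++ tail I).getD
        (8 + I.m + I.n * I.m + i * (I.m.choose 2 + 1) + I.order i c) 0 = _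
      have hlt := lt_choose_two_add_one (I.order i c).2
      rw [add_assoc _ ((i : ℕ) * _), CBPData.getD_encode_append,
        getD_flatten_ofFn _ (hrow I) i hlt]
      simp [List.getD_eq_getElem?_getD, hlt]
    have h8 : ∀ x : Fin I.m, (I.input (tail I) (I.m.choose 2 + 1)).inp (8 + x) =
        if x ∈ I.coalition then 1 else 0 := fun x => CBPData.getD_encode_coalition _ _ x
    change _ + (if _ then ∑ x ∈ Finset.range I.m, _ else 0) = _
    rw [Finset.sum_range, ShiftInstance.topPrice, CBPData.rank_input, hp]
    simp only [CBPData.rank_input, Fin.val_fin_lt, h8]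
    simp
    rfl
  · have := I.rank_input (t := tail I) (r := I.m.choose 2 + 1) ⟨i, hi⟩ ⟨c, hc⟩
    rw [this]
    exact lt_choose_two_add_one (Fin.is_lt _)
  · change 8 + I.m + I.n * I.m + I.n * (I.m.choose 2 + 1) ≤ (I.toCBPData.encode ++ tail I).length
    rw [List.length_append, CBPData.length_encode, length_flatten_ofFn _ (hrow I)]

end Bribery

theorem mainTheorem2 :
    RAM.PolyTimeDecidable Bribery.SwapInstance.encode Bribery.SwapInstance.PluralityCBP ∧
    RAM.PolyTimeDecidable Bribery.ShiftInstance.encode Bribery.ShiftInstance.PluralityCBP :=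
  ⟨Bribery.SwapInstance.polyTimeDecidable, Bribery.ShiftInstance.polyTimeDecidable⟩
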